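/- Let $0<k<1$, $l_k(t)=1+kt$, $Q^k=\{(x,t): 0<x<l_k(t),\ t>0\}$ and, for $T>0$, $Q^k_T=\{(x,t)\in Q^k: t<T\}$. For $a\in\mathbb R$ and initial data $(u^0,u^1)\in H^1(0,1)\times L^2(0,1)$ consider $$u_{tt}-u_{xx}=0\ \text{in }Q^k,\qquad u_x(0,t)=0,\quad u_x(l_k(t),t)+a\,u_t(l_k(t),t)=0\ \ (t>0),\qquad u(x,0)=u^0(x),\ u_t(x,0)=u^1(x)\ \ (0<x<1).$$ A solution is a weak solution $u\in H^1_{loc}(Q^k)$ (weak first derivatives square integrable on every $Q^k_T$), represented by its continuous extension to $\overline{Q^k}$; the equation holds in the sense of distributions, and the boundary conditions and the condition on $u_t(\cdot,0)$ hold almost everywhere, the boundary values of $u_x,u_t$ being one-sided derivatives from inside the domain. The energy is $$E(t)=\frac12\int_0^{l_k(t)}\big[u_t^2(x,t)+u_x^2(x,t)\big]\,dx,\qquad t\ge 0 .$$ "Increasing" ("decreasing") means: for every solution, $E$ is nondecreasing (nonincreasing) on $[0,\infty)$, and whenever $E(s)>0$ there is $t>s$ with $E(t)>E(s)$ (resp.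 $E(t)<E(s)$). **Theorem 1.1.** Put $$a_1=\frac{1-\sqrt{1-k^2}}{k},\quad a_2=\frac{1+\sqrt{1-k^2}}{k},\quad b_1=k,\quad b_2=\frac1k .$$ Then $a_1<b_1<b_2<a_2$. For every solution and every $t\ge0$ the derivatives $u_t(x,t)$, $u_x(x,t)$ exist for almost every $x\in(0,l_k(t))$ (with $u_t$ one-sided at $t=0$), and $E(t)$ is finite. Moreover: (1) If $a<a_1$ or $a>a_2$, the energy is increasing. If in addition $a\neq-1$, there are a solution with $E(0)>0$ and constants $\gamma,c_1,c_2>0$ such that $c_1(1+t)^{\gamma}E(0)\le E(t)\le c_2(1+t)^{\gamma}E(0)$ for all $t\ge0$. (2) If $a=a_1$ or $a=a_2$, the energy of every solution is conserved: $E(t)=E(0)$ for all $t\ge0$. (3) If $a_1<a<a_2$, the energy is decreasing. If in addition $a\ne1$, there are a solution with $E(0)>0$ and constants $\gamma,c_1,c_2>0$ such that $c_1(1+t)^{-\gamma}E(0)\le E(t)\le c_2(1+t)^{-\gamma}E(0)$ for all $t\ge0$. Furthermore: - If $a=b_1$ or $a=b_2$, the energy decays only at a rate of first-order polynomials: there are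 $c_1,c_2>0$ and a real polynomial $\varphi$ of degree $1$, positive on $[0,\infty)$, with $c_1\varphi(t)^{-1}E(0)\le E(t)\le c_2E(0)\varphi(t)^{-1}$ for every solution and all $t\ge0$. Explicitly, for every solution and all $T\ge0$, $$\frac{1-k}{(1+k)(1+kT)}E(0)\le E(T)\le\frac{1+k}{(1-k)(1+kT)}E(0).$$ - If $b_1<a<b_2$, the rate is no less than first order: there are $C>0$ and a real polynomial $\varphi$ of degree $1$, positive on $[0,\infty)$, with $E(t)\le C E(0)\varphi(t)^{-1}$ for every solution and all $t\ge0$. - If $a_1<a<b_1$ or $b_2<a<a_2$, the rate is no more than first order: there are $C>0$ and a real polynomial $\varphi$ of degree $1$, positive on $[0,\infty)$, with $E(t)\ge C E(0)\varphi(t)^{-1}$ for every solution and all $t\ge0$. Here $C,c_1,c_2,\varphi$ in the three items depend only on $k$ and $a$, not on the solution. -/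

import Mathlib

open MeasureTheory Set
open scoped ContDiff

noncomputable section

namespace MovingWave

/-- The position `l_k(t) = 1 + k t` of the moving end. -/
def endpoint (k t : ℝ) : ℝ := 1 + k * t

/-- The space-time domain `Q^k`; points are pairs `(x, t)`. -/
def domain (k : ℝ) : Set (ℝ × ℝ) :=
  {z | 0 < z.1 ∧ z.1 < endpoint k z.2 ∧ 0 < z.2}

/-- The truncated domain `Q^k_T`. -/
def domainUpTo (k T : ℝ) : Set (ℝ × ℝ) := {z | z ∈ domain k ∧ z.2 < T}

/-- Classical partial derivative in the space variable. -/
def pdx (φ : ℝ × ℝ → ℝ) (z : ℝ × ℝ) : ℝ := deriv (fun x => φ (x, z.2)) z.1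

/-- Classical partial derivative in the time variable. -/
def pdt (φ : ℝ × ℝ → ℝ) (z : ℝ × ℝ) : ℝ := deriv (fun t => φ (z.1, t)) z.2

/-- Smooth functions with compact support contained in `Ω`. -/
def IsTestFunction (Ω : Set (ℝ × ℝ)) (φ : ℝ × ℝ → ℝ) : Prop :=
  ContDiff ℝ ∞ φ ∧ HasCompactSupport φ ∧ tsupport φ ⊆ Ω

/-- A continuous function on the closure of `Q^k` is in `H^1_loc` (up to the boundary): it has weak
first derivatives in `Q^k` which are square integrable on every `Q^k_T`. The function itself
is automatically square integrable on the bounded sets `Q^k_T`. -/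
def MemH1loc (k : ℝ) (u : ℝ × ℝ → ℝ) : Prop :=
  ContinuousOn u (closure (domain k)) ∧
  ∃ p q : ℝ × ℝ → ℝ,
    (∀ T : ℝ, 0 < T →
      MemLp p 2 (volume.restrict (domainUpTo k T)) ∧
      MemLp q 2 (volume.restrict (domainUpTo k T))) ∧
    ∀ φ : ℝ × ℝ → ℝ, IsTestFunction (domain k) φ →
      (∫ z in domain k, u z * pdx φ z = - ∫ z in domain k, p z * φ z) ∧
      (∫ z in domain k, u z * pdt φ z = - ∫ z in domain k, q z * φ z)

/-- `v` is (the continuous representative of) an element of `H^1(0,1)`: it is a primitive of a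
square integrable function. -/
def MemH1UnitInterval (v : ℝ → ℝ) : Prop :=
  ∃ w : ℝ → ℝ, MemLp w 2 (volume.restrict (Ioo (0 : ℝ) 1)) ∧
    ∀ x ∈ Icc (0 : ℝ) 1, v x = v 0 + ∫ y in (0 : ℝ)..x, w y

/-- `u` is the continuous representative of a weak solution in `H^1_loc(Q^k)`, with data
`(u⁰, u¹) ∈ H^1(0,1) × L^2(0,1)`, of
`u_tt - u_xx = 0` in `Q^k`, `u_x(0,t) = 0`, `u_x(l_k(t),t) + a u_t(l_k(t),t) = 0` for `t > 0`,
`u(x,0) = u⁰`, `u_t(x,0) = u¹` for `x ∈ (0,1)`.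

The equation holds in the sense of distributions. The values of `u_x` and `u_t` on the
boundary are the classical one-sided derivatives from inside the domain, which are required at
almost every boundary point: an `H^1_loc` solution of the wave equation is a sum of a locally
absolutely continuous function of `t + x` and one of `t - x`, so these derivatives are its traces.
Since `l_k` is increasing, `(l_k(t), s)` lies in the closed domain for every `s ≥ t`. -/
structure IsWeakSolution (k a : ℝ) (u₀ u₁ : ℝ → ℝ) (u : ℝ × ℝ → ℝ) : Prop where
  data_pos : MemH1UnitInterval u₀
  data_vel : MemLp u₁ 2 (volume.restrict (Ioo (0 : ℝ) 1))
  memH1loc : MemH1loc k u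
  wave : ∀ φ : ℝ × ℝ → ℝ, IsTestFunction (domain k) φ →
    ∫ z in domain k, u z * (pdt (pdt φ) z - pdx (pdx φ) z) = 0
  left_bc : ∀ᵐ t ∂(volume.restrict (Ioi (0 : ℝ))),
    HasDerivWithinAt (fun x => u (x, t)) 0 (Ici 0) 0
  right_bc : ∀ᵐ t ∂(volume.restrict (Ioi (0 : ℝ))), ∃ ux ut : ℝ,
    HasDerivWithinAt (fun x => u (x, t)) ux (Iic (endpoint k t)) (endpoint k t) ∧
    HasDerivWithinAt (fun s => u (endpoint k t, s)) ut (Ici t) t ∧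
    ux + a * ut = 0
  init_pos : ∀ x ∈ Icc (0 : ℝ) 1, u (x, 0) = u₀ x
  init_vel : ∀ᵐ x ∂(volume.restrict (Ioo (0 : ℝ) 1)),
    HasDerivWithinAt (fun s => u (x, s)) (u₁ x) (Ici 0) 0

/-- `u_t^2 + u_x^2` at `(x, t)`, `t ≥ 0`. The time derivative is taken within `[0, ∞)`: this is the
usual derivative for `t > 0` and the one-sided derivative for `t = 0`. -/
def energyDensity (u : ℝ × ℝ → ℝ) (t x : ℝ) : ℝ :=
  (derivWithin (fun s => u (x, s)) (Ici 0) t) ^ 2 + (deriv (fun y => u (y, t)) x) ^ 2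

/-- The energy `E_1(t) = (1/2) ∫_0^{l_k(t)} (u_t^2 + u_x^2) dx`. -/
def energy (k : ℝ) (u : ℝ × ℝ → ℝ) (t : ℝ) : ℝ :=
  1 / 2 * ∫ x in (0 : ℝ)..(endpoint k t), energyDensity u t x

/-- The energy at time `t` is meaningful: both partial derivatives exist at almost every point of
the segment `(0, l_k(t))`, and `u_t^2 + u_x^2` is integrable there. -/
def EnergyWellDefined (k : ℝ) (u : ℝ × ℝ → ℝ) (t : ℝ) : Prop :=
  (∀ᵐ x ∂(volume.restrict (Ioo (0 : ℝ) (endpoint k t))),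
    DifferentiableWithinAt ℝ (fun s => u (x, s)) (Ici 0) t ∧
    DifferentiableAt ℝ (fun y => u (y, t)) x) ∧
  IntervalIntegrable (energyDensity u t) volume 0 (endpoint k t)

/-- The energy of every solution is nondecreasing, and it never becomes constant from some time on
unless it vanishes at that time. -/
def EnergyIncreasing (k a : ℝ) : Prop :=
  ∀ u₀ u₁ u, IsWeakSolution k a u₀ u₁ u →
    MonotoneOn (energy k u) (Ici 0) ∧
    ∀ s : ℝ, 0 ≤ s → 0 < energy k u s → ∃ t : ℝ, s < t ∧ energy k u s < energy k u t

/-- The energy of every solution is constant in time. -/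
def EnergyConserved (k a : ℝ) : Prop :=
  ∀ u₀ u₁ u, IsWeakSolution k a u₀ u₁ u → ∀ t : ℝ, 0 ≤ t → energy k u t = energy k u 0

/-- The energy of every solution is nonincreasing, and it never becomes constant from some time on
unless it vanishes at that time. -/
def EnergyDecreasing (k a : ℝ) : Prop :=
  ∀ u₀ u₁ u, IsWeakSolution k a u₀ u₁ u →
    AntitoneOn (energy k u) (Ici 0) ∧
    ∀ s : ℝ, 0 ≤ s → 0 < energy k u s → ∃ t : ℝ, s < t ∧ energy k u t < energy k u s

/-- A real polynomial of degree `m` that is positive on `[0, ∞)`. -/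
def IsRatePolynomial (m : ℕ) (φ : Polynomial ℝ) : Prop :=
  φ.natDegree = m ∧ ∀ t : ℝ, 0 ≤ t → 0 < φ.eval t

/-- The energy decays only at a rate of `m`-th order polynomials. -/
def DecaysExactlyAtOrder (k a : ℝ) (m : ℕ) : Prop :=
  ∃ c₁ c₂ : ℝ, 0 < c₁ ∧ 0 < c₂ ∧ ∃ φ : Polynomial ℝ, IsRatePolynomial m φ ∧
    ∀ u₀ u₁ u, IsWeakSolution k a u₀ u₁ u → ∀ t : ℝ, 0 ≤ t →
      c₁ * (φ.eval t)⁻¹ * energy k u 0 ≤ energy k u t ∧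
      energy k u t ≤ c₂ * energy k u 0 * (φ.eval t)⁻¹

/-- The energy decays at a rate which is no less than `m`-th order polynomials. -/
def DecaysAtLeastAtOrder (k a : ℝ) (m : ℕ) : Prop :=
  ∃ C : ℝ, 0 < C ∧ ∃ φ : Polynomial ℝ, IsRatePolynomial m φ ∧
    ∀ u₀ u₁ u, IsWeakSolution k a u₀ u₁ u → ∀ t : ℝ, 0 ≤ t →
      energy k u t ≤ C * energy k u 0 * (φ.eval t)⁻¹

/-- The energy decays at a rate which is no more than `m`-th order polynomials. -/
def DecaysAtMostAtOrder (k a : ℝ) (m : ℕ) : Prop :=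
  ∃ C : ℝ, 0 < C ∧ ∃ φ : Polynomial ℝ, IsRatePolynomial m φ ∧
    ∀ u₀ u₁ u, IsWeakSolution k a u₀ u₁ u → ∀ t : ℝ, 0 ≤ t →
      C * energy k u 0 * (φ.eval t)⁻¹ ≤ energy k u t

/-- The energy of the solution `u` is not zero and is comparable with the power `(1 + t)^r`. -/
def EnergyComparableToPower (k : ℝ) (u : ℝ × ℝ → ℝ) (r : ℝ) : Prop :=
  0 < energy k u 0 ∧ ∃ c₁ c₂ : ℝ, 0 < c₁ ∧ 0 < c₂ ∧ ∀ t : ℝ, 0 ≤ t →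
    c₁ * (1 + t) ^ r * energy k u 0 ≤ energy k u t ∧
    energy k u t ≤ c₂ * (1 + t) ^ r * energy k u 0

/-- Some solution has nonzero energy growing exactly like a positive power of time. -/
def ExistsPolynomialGrowth (k a : ℝ) : Prop :=
  ∃ u₀ u₁ u, IsWeakSolution k a u₀ u₁ u ∧
    ∃ γ : ℝ, 0 < γ ∧ EnergyComparableToPower k u γ

/-- Some solution has nonzero energy decaying exactly like a negative power of time. -/
def ExistsPolynomialDecay (k a : ℝ) : Prop :=
  ∃ u₀ u₁ u, IsWeakSolution k a u₀ u₁ u ∧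
    ∃ γ : ℝ, 0 < γ ∧ EnergyComparableToPower k u (-γ)

end MovingWave

end

/-! Everything reduces to a scaling law for one function of one variable. By d'Alembert, `u = F(t +
x) + G(t - x)`. The Neumann condition at `x = 0` gives `F' = G' = g` almost everywhere on `(0, ∞)`,
so a solution is encoded by a profile `g` on `(-1, ∞)`. Since `u_t ± u_x` equals `2 g(t ± x)`, the
energy is the integral of `g ^ 2` over the window from `(1 - k) t - 1` to `(1 + k) t + 1`, the
characteristic coordinates of the moving end. The condition there reads `(1 + a) g((1 + k) t + 1) =
(1 - a) g((1 - k) t - 1)` (`IsWeakSolution.exists_profile`).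

In the variable `1 + k s` the passage from the left to the right end of the window is multiplication
by `ρ = (1 + k) / (1 - k)`. Hence it is natural to weight `g ^ 2` with `(1 + k s) ^ β`: as time
passes, what enters the window on the right is `((1 - a) / (1 + a)) ^ 2 * ρ ^ (1 + β)` times what
leaves on the left, and the weighted energy is monotone according to whether this factor is above or
below `1` (`IsProfile.weightedEnergy_sub`). On the window the weight is comparable with `(1 + k t) ^
β` (`IsProfile.weightedEnergy_bounds`).

Three choices of `β` give all the claims. For `β = 0` the factor minus `1` has the sign of `k a ^ 2
- 2 a + k`, with roots `a₁`, `a₂`: this is growth, conservation or decay. For `β = 1` it has the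
sign of `(k - a) (1 - a k)`, with roots `k` and `1 / k`: these are the first-order bounds. If `a ≠
±1`, some `β` makes the factor equal to `1`, and every energy is comparable with `(1 + t) ^ (-β)`.
For `a = -1` the functional equation forces `g = 0`; for `a = 1` the factor is `0` for every `β`.

The analytic work is the justification of d'Alembert's formula for weak solutions: in characteristic
coordinates the mixed derivative vanishes weakly, and the lemma of du Bois-Reymond, applied one
variable at a time, separates the variables (`CharSystem.dalembert`). Conversely, smooth profiles
give solutions (`isWeakSolution_of_profile`), and an explicit one (`exists_smooth_profile`) supplies
the nonzero examples. -/

noncomputable section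

namespace MovingWave

/-! ### Weak derivatives in one variable -/

/-- A compact subset of an open interval lies in a compact subinterval. -/
lemma exists_Icc_of_isCompact_subset_Ioo {a b : ℝ} (hab : a < b) {K : Set ℝ} (hK : IsCompact K)
    (h : K ⊆ Ioo a b) : ∃ a' b', a < a' ∧ a' ≤ b' ∧ b' < b ∧ K ⊆ Icc a' b' := by
  -- The midpoint is added so that the infimum and supremum are attained even if `K` is empty.
  set L := insert ((a + b) / 2) K with hLdef
  have hL : IsCompact L := hK.insert _
  have hLn : L.Nonempty := insert_nonempty _ _
  have hLs : L ⊆ Ioo a b := by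
    intro x hx
    rcases hx with rfl | hx
    · constructor <;> linarith
    · exact h hx
  have h1 := hL.sInf_mem hLn
  have h2 := hL.sSup_mem hLn
  refine ⟨sInf L, sSup L, (hLs h1).1, ?_, (hLs h2).2, fun x hx => ?_⟩
  · exact csInf_le hL.bddBelow h2
  · exact ⟨csInf_le hL.bddBelow (mem_insert_of_mem _ hx),
      le_csSup hL.bddAbove (mem_insert_of_mem _ hx)⟩

/-- A test function on an interval with zero mean is the derivative of a test function. -/
lemma exists_primitive_test {a b : ℝ} (hab : a < b) {φ : ℝ → ℝ} (hφ : ContDiff ℝ ∞ φ)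
    (hs : tsupport φ ⊆ Ioo a b) (h0 : ∫ x in a..b, φ x = 0) :
    ∃ A : ℝ → ℝ, ContDiff ℝ ∞ A ∧ tsupport A ⊆ Ioo a b ∧ deriv A = φ := by
  have hc : IsCompact (tsupport φ) :=
    isCompact_Icc.of_isClosed_subset (isClosed_tsupport φ) (hs.trans Ioo_subset_Icc_self)
  obtain ⟨a', b', ha, hab', hb, hsub⟩ := exists_Icc_of_isCompact_subset_Ioo hab hc hs
  have hcont := hφ.continuous
  have hzero : ∀ x, x ∉ Icc a' b' → φ x = 0 := fun x hx =>
    image_eq_zero_of_notMem_tsupport fun h => hx (hsub h)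
  have hd : ∀ x, HasDerivAt (fun x => ∫ y in a..x, φ y) (φ x) x := fun x =>
    intervalIntegral.integral_hasDerivAt_right (hcont.intervalIntegrable _ _)
      (hcont.stronglyMeasurableAtFilter _ _) hcont.continuousAt
  have hderiv : deriv (fun x => ∫ y in a..x, φ y) = φ := funext fun x => (hd x).deriv
  refine ⟨fun x => ∫ y in a..x, φ y, ?_, ?_, hderiv⟩
  · rw [contDiff_infty_iff_deriv, hderiv]
    exact ⟨fun x => (hd x).differentiableAt, hφ⟩
  · refine (closure_minimal ?_ isClosed_Icc).trans (Icc_subset_Ioo ha hb)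
    intro x hx
    by_contra hxn
    apply hx
    rw [mem_Icc, not_and_or, not_le, not_le] at hxn
    rcases hxn with hxn | hxn
    · change ∫ y in a..x, φ y = 0
      rw [intervalIntegral.integral_congr (g := fun _ => (0 : ℝ))]
      · simp
      · intro y hy
        apply hzero
        rintro ⟨h1, -⟩
        have := hy.2
        have : y ≤ max a x := this
        rcases le_max_iff.1 this with h | h <;> linarith
    · change ∫ y in a..x, φ y = 0
      -- To the right of `b'` the zero mean enters: the integral up to `x` is the full mean minus a
      -- vanishing tail.
      have : ∫ y in x..b, φ y = 0 := by
        rw [intervalIntegral.integral_congr (g := fun _ => (0 : ℝ))]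
        · simp
        · intro y hy
          apply hzero
          rintro ⟨-, h1⟩
          have : min x b ≤ y := hy.1
          rcases min_le_iff.1 this with h | h <;> linarith
      rw [← h0, ← intervalIntegral.integral_add_adjacent_intervals (hcont.intervalIntegrable a x)
        (hcont.intervalIntegrable x b), this, add_zero]

/-- There is a test function on `(a, b)` with integral one. -/
lemma exists_test_integral_one {a b : ℝ} (hab : a < b) :
    ∃ χ : ℝ → ℝ, ContDiff ℝ ∞ χ ∧ tsupport χ ⊆ Ioo a b ∧ ∫ x in a..b, χ x = 1 := by
  let B : ContDiffBump ((a + b) / 2) :=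
    ⟨(b - a) / 8, (b - a) / 4, by linarith, by linarith⟩
  have hs : tsupport (B.normed volume) ⊆ Ioo a b := by
    rw [B.tsupport_normed_eq, Real.closedBall_eq_Icc]
    apply Icc_subset_Ioo <;> simp only [B] <;> linarith
  refine ⟨B.normed volume, B.contDiff_normed, hs, ?_⟩
  rw [intervalIntegral.integral_of_le hab.le, setIntegral_eq_integral_of_forall_compl_eq_zero,
    B.integral_normed]
  intro x hx
  exact image_eq_zero_of_notMem_tsupport fun h => hx (Ioo_subset_Ioc_self (hs h))

/-- The lemma of du Bois-Reymond: a continuous function with integrable weak derivative `f` is a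
primitive of `f`. -/
lemma sub_eq_integral_of_weak_deriv {a b : ℝ} (hab : a < b) {V f : ℝ → ℝ}
    (hV : ContinuousOn V (Icc a b)) (hf : IntervalIntegrable f volume a b)
    (h : ∀ A : ℝ → ℝ, ContDiff ℝ ∞ A → tsupport A ⊆ Ioo a b →
      ∫ s in a..b, V s * deriv A s = - ∫ s in a..b, f s * A s)
    {s₁ s₂ : ℝ} (h1 : s₁ ∈ Icc a b) (h2 : s₂ ∈ Icc a b) :
    V s₁ - V s₂ = ∫ s in s₂..s₁, f s := by
  obtain ⟨χ, hχ, hχs, hχ1⟩ := exists_test_integral_one hab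
  set P : ℝ → ℝ := fun s => ∫ y in a..s, f y with hP
  have hPac : AbsolutelyContinuousOnInterval P a b :=
    hf.absolutelyContinuousOnInterval_intervalIntegral (by simp)
  have hPc : ContinuousOn P (Icc a b) := by simpa [uIcc_of_le hab.le] using hPac.continuousOn
  -- `K` has zero weak derivative; the goal is that it is constant.
  set K : ℝ → ℝ := fun s => V s - P s with hKdef
  have hK : ContinuousOn K (Icc a b) := hV.sub hPc
  have hK' : ContinuousOn K (uIcc a b) := by rwa [uIcc_of_le hab.le]
  have hV' : ContinuousOn V (uIcc a b) := by rwa [uIcc_of_le hab.le]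
  have hPc' : ContinuousOn P (uIcc a b) := by rwa [uIcc_of_le hab.le]
  have hKA : ∀ A : ℝ → ℝ, ContDiff ℝ ∞ A → tsupport A ⊆ Ioo a b →
      ∫ s in a..b, K s * deriv A s = 0 := by
    intro A hA hAs
    have hAac : AbsolutelyContinuousOnInterval A a b :=
      ContDiffOn.absolutelyContinuousOnInterval (hA.of_le (by simp)).contDiffOn
    have hA' : Continuous (deriv A) := hA.continuous_deriv (by simp)
    have hAa : A a = 0 := image_eq_zero_of_notMem_tsupport fun h => lt_irrefl _ (hAs h).1
    have hAb : A b = 0 := image_eq_zero_of_notMem_tsupport fun h => lt_irrefl _ (hAs h).2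
    have hparts := hPac.integral_mul_deriv_eq_deriv_mul hAac
    have hae : ∫ s in a..b, deriv P s * A s = ∫ s in a..b, f s * A s := by
      apply intervalIntegral.integral_congr_ae
      filter_upwards [hf.ae_hasDerivAt_integral] with x hx hxm
      rw [(hx (uIoc_subset_uIcc hxm) a (by simp)).deriv]
    rw [hae, hAa, hAb] at hparts
    simp only [hKdef, sub_mul]
    rw [intervalIntegral.integral_sub, h A hA hAs, hparts]
    · ring
    · exact (hV'.mul hA'.continuousOn).intervalIntegrable
    · exact (hPc'.mul hA'.continuousOn).intervalIntegrable
  set c := ∫ s in a..b, K s * χ s with hc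
  have hae : ∀ᵐ x ∂(volume : Measure ℝ), x ∈ Ioo a b → K x - c = 0 := by
    apply isOpen_Ioo.ae_eq_zero_of_integral_contDiff_smul_eq_zero
    · exact ((hK.mono Ioo_subset_Icc_self).sub continuousOn_const).locallyIntegrableOn
        measurableSet_Ioo
    · intro g hg hgc hgs
      -- Subtracting the right multiple of `χ` makes an arbitrary test function a derivative of a
      -- test function, against which `K` integrates to zero. So `K` acts on `g` as the constant
      -- `c`.
      have hmean : ∫ x in a..b, (g x - (∫ y in a..b, g y) * χ x) = 0 := by
        rw [intervalIntegral.integral_sub (hg.continuous.intervalIntegrable _ _)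
          ((hχ.continuous.const_mul _).intervalIntegrable _ _),
          intervalIntegral.integral_const_mul, hχ1]
        ring
      have hsup : tsupport (fun x => g x - (∫ y in a..b, g y) * χ x) ⊆ Ioo a b := by
        refine (tsupport_sub _ _).trans (union_subset hgs ?_)
        exact (tsupport_mul_subset_right).trans hχs
      obtain ⟨A, hA, hAs, hdA⟩ := exists_primitive_test hab
        (hg.sub (contDiff_const.mul hχ)) hsup hmean
      have h0 := hKA A hA hAs
      rw [hdA] at h0
      have hset : ∫ x, g x • (K x - c) = ∫ x in a..b, g x * (K x - c) := by
        rw [intervalIntegral.integral_of_le hab.le, setIntegral_eq_integral_of_forall_compl_eq_zero]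
        · rfl
        · intro x hx
          rw [image_eq_zero_of_notMem_tsupport fun h => hx (Ioo_subset_Ioc_self (hgs h)), zero_mul]
      rw [hset]
      have e1 : ∫ x in a..b, g x * (K x - c) = (∫ x in a..b, K x * g x) - c * ∫ x in a..b, g x := by
        rw [← intervalIntegral.integral_const_mul, ← intervalIntegral.integral_sub]
        · congr 1; ext x; ring
        · exact (hK'.mul hg.continuous.continuousOn).intervalIntegrable
        · exact (continuous_const.mul hg.continuous).intervalIntegrable _ _
      have e2 : ∫ x in a..b, K x * (g x - (∫ y in a..b, g y) * χ x)
          = (∫ x in a..b, K x * g x) - (∫ y in a..b, g y) * c := by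
        rw [hc, ← intervalIntegral.integral_const_mul, ← intervalIntegral.integral_sub]
        · congr 1; ext x; ring
        · exact (hK'.mul hg.continuous.continuousOn).intervalIntegrable
        · exact (continuousOn_const.mul (hK'.mul hχ.continuous.continuousOn)).intervalIntegrable
      rw [e1]
      rw [e2] at h0
      linarith
  have hIoo : EqOn K (fun _ => c) (Ioo a b) := by
    apply Measure.eqOn_Ioo_of_ae_eq volume (a := a) (b := b) ?_ (hK.mono Ioo_subset_Icc_self)
      continuousOn_const
    rw [Filter.EventuallyEq, ae_restrict_iff' measurableSet_Ioo]
    filter_upwards [hae] with x hx hxm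
    linarith [hx hxm]
  have hIcc : EqOn K (fun _ => c) (Icc a b) :=
    hIoo.of_subset_closure hK continuousOn_const Ioo_subset_Icc_self
      (by rw [closure_Ioo hab.ne])
  have e1 := hIcc h1
  have e2 := hIcc h2
  have : P s₁ - P s₂ = ∫ s in s₂..s₁, f s := by
    rw [hP]
    apply intervalIntegral.integral_interval_sub_left
    · exact hf.mono_set (uIcc_subset_uIcc (by simp) (by rwa [uIcc_of_le hab.le]))
    · exact hf.mono_set (uIcc_subset_uIcc (by simp) (by rwa [uIcc_of_le hab.le]))
  simp only [hKdef] at e1 e2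
  linarith

/-- The Cauchy-Schwarz inequality for interval integrals. -/
lemma sq_integral_mul_le {c d : ℝ} (hcd : c ≤ d) {r B : ℝ → ℝ}
    (hr2 : IntervalIntegrable (fun y => r y ^ 2) volume c d)
    (hrB : IntervalIntegrable (fun y => r y * B y) volume c d)
    (hB2 : IntervalIntegrable (fun y => B y ^ 2) volume c d) :
    (∫ y in c..d, r y * B y) ^ 2 ≤ (∫ y in c..d, B y ^ 2) * ∫ y in c..d, r y ^ 2 := by
  -- The quadratic polynomial is the integral of `(x B - r) ^ 2`; its discriminant is therefore
  -- nonpositive.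
  have h : ∀ x : ℝ, 0 ≤ (∫ y in c..d, B y ^ 2) * (x * x) + (-2 * ∫ y in c..d, r y * B y) * x
      + ∫ y in c..d, r y ^ 2 := by
    intro x
    have e : ∫ y in c..d, (x * B y - r y) ^ 2 = (∫ y in c..d, B y ^ 2) * (x * x)
        + (-2 * ∫ y in c..d, r y * B y) * x + ∫ y in c..d, r y ^ 2 := by
      have : ∀ y, (x * B y - r y) ^ 2 = (x * x) * B y ^ 2 + (-2 * x) * (r y * B y) + r y ^ 2 :=
        fun y => by ring
      simp only [this]
      rw [intervalIntegral.integral_add ((hB2.const_mul _).add (hrB.const_mul _)) hr2,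
        intervalIntegral.integral_add (hB2.const_mul _) (hrB.const_mul _),
        intervalIntegral.integral_const_mul, intervalIntegral.integral_const_mul]
      ring
    rw [← e]
    exact intervalIntegral.integral_nonneg hcd fun y _ => sq_nonneg _
  have := discrim_le_zero h
  rw [discrim] at this
  nlinarith

/-! ### Separation of variables in characteristic coordinates -/

/-- A convex set containing the corners of a box contains the box. -/
lemma box_subset_of_convex {Ω : Set (ℝ × ℝ)} (hΩ : Convex ℝ Ω) {a b c d : ℝ}
    (h1 : (a, c) ∈ Ω) (h2 : (b, c) ∈ Ω) (h3 : (a, d) ∈ Ω) (h4 : (b, d) ∈ Ω) :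
    Icc a b ×ˢ Icc c d ⊆ Ω := by
  have hx : ∀ y, Convex ℝ {x | (x, y) ∈ Ω} := by
    intro y x hx x' hx' p q hp hq hpq
    have := hΩ hx hx' hp hq hpq
    simpa [← add_mul, hpq] using this
  have hy : ∀ x, Convex ℝ {y | (x, y) ∈ Ω} := by
    intro x y hy y' hy' p q hp hq hpq
    have := hΩ hy hy' hp hq hpq
    simpa [← add_mul, hpq] using this
  rintro ⟨x, y⟩ ⟨hxm, hym⟩
  exact (hy x).ordConnected.out ((hx c).ordConnected.out h1 h2 hxm)
    ((hx d).ordConnected.out h3 h4 hxm) hym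

/-- A function `U` on an open convex set `Ω` in characteristic coordinates, with weak derivatives
`R` and `S`, locally square integrable, and vanishing weak mixed second derivative. All the weak
identities are tested with products of functions of one variable. -/
structure CharSystem (Ω : Set (ℝ × ℝ)) (U R S : ℝ × ℝ → ℝ) : Prop where
  isOpen : IsOpen Ω
  convex : Convex ℝ Ω
  cont : ContinuousOn U Ω
  memR : ∀ K ⊆ Ω, IsCompact K → MemLp R 2 (volume.restrict K)
  memS : ∀ K ⊆ Ω, IsCompact K → MemLp S 2 (volume.restrict K)
  weakR : ∀ A B : ℝ → ℝ, ContDiff ℝ ∞ A → ContDiff ℝ ∞ B → HasCompactSupport A →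
    HasCompactSupport B → tsupport A ×ˢ tsupport B ⊆ Ω →
    ∫ w in Ω, U w * (deriv A w.1 * B w.2) = - ∫ w in Ω, R w * (A w.1 * B w.2)
  weakS : ∀ A B : ℝ → ℝ, ContDiff ℝ ∞ A → ContDiff ℝ ∞ B → HasCompactSupport A →
    HasCompactSupport B → tsupport A ×ˢ tsupport B ⊆ Ω →
    ∫ w in Ω, U w * (A w.1 * deriv B w.2) = - ∫ w in Ω, S w * (A w.1 * B w.2)
  weakRS : ∀ A B : ℝ → ℝ, ContDiff ℝ ∞ A → ContDiff ℝ ∞ B → HasCompactSupport A →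
    HasCompactSupport B → tsupport A ×ˢ tsupport B ⊆ Ω →
    ∫ w in Ω, U w * (deriv A w.1 * deriv B w.2) = 0

/-- Exchanging coordinates in an integral over a planar set. -/
lemma setIntegral_swap (Ω : Set (ℝ × ℝ)) (G : ℝ × ℝ → ℝ) :
    ∫ w in Prod.swap ⁻¹' Ω, G w.swap = ∫ w in Ω, G w :=
  (Measure.measurePreserving_swap (μ := (volume : Measure ℝ))
    (ν := (volume : Measure ℝ))).setIntegral_preimage_emb
    MeasurableEquiv.prodComm.measurableEmbedding G Ω

/-- The two characteristic variables play symmetric roles, so regularity need only be proved in the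
first one. -/
lemma CharSystem.swap {Ω : Set (ℝ × ℝ)} {U R S : ℝ × ℝ → ℝ} (h : CharSystem Ω U R S) :
    CharSystem (Prod.swap ⁻¹' Ω) (U ∘ Prod.swap) (S ∘ Prod.swap) (R ∘ Prod.swap) := by
  have hmem : ∀ Q : ℝ × ℝ → ℝ, (∀ K ⊆ Ω, IsCompact K → MemLp Q 2 (volume.restrict K)) →
      ∀ K ⊆ Prod.swap ⁻¹' Ω, IsCompact K → MemLp (Q ∘ Prod.swap) 2 (volume.restrict K) := by
    intro Q hQ K hK hKc
    have h1 := hQ (Prod.swap '' K) (by rintro _ ⟨x, hx, rfl⟩; exact hK hx)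
      (hKc.image continuous_swap)
    have hpre : Prod.swap ⁻¹' (Prod.swap '' K) = K :=
      Function.Injective.preimage_image Prod.swap_injective K
    have mp := (Measure.measurePreserving_swap (μ := (volume : Measure ℝ))
      (ν := (volume : Measure ℝ))).restrict_preimage_emb
      MeasurableEquiv.prodComm.measurableEmbedding (Prod.swap '' K)
    rw [hpre] at mp
    exact h1.comp_measurePreserving mp
  have hsub : ∀ A B : ℝ → ℝ, tsupport A ×ˢ tsupport B ⊆ Prod.swap ⁻¹' Ω →
      tsupport B ×ˢ tsupport A ⊆ Ω := by
    rintro A B hAB ⟨x, y⟩ ⟨hx, hy⟩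
    exact @hAB (y, x) ⟨hy, hx⟩
  refine ⟨h.isOpen.preimage continuous_swap, ?_, h.cont.comp continuous_swap.continuousOn
    (mapsTo_preimage _ _), hmem S h.memS, hmem R h.memR, ?_, ?_, ?_⟩
  · exact h.convex.is_linear_preimage ⟨fun _ _ => rfl, fun _ _ => rfl⟩
  · intro A B hA hB hAc hBc hAB
    have := h.weakS B A hB hA hBc hAc (hsub A B hAB)
    rw [← setIntegral_swap, ← setIntegral_swap Ω] at this
    simpa [mul_comm, mul_left_comm] using this
  · intro A B hA hB hAc hBc hAB
    have := h.weakR B A hB hA hBc hAc (hsub A B hAB)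
    rw [← setIntegral_swap, ← setIntegral_swap Ω] at this
    simpa [mul_comm, mul_left_comm] using this
  · intro A B hA hB hAc hBc hAB
    have := h.weakRS B A hB hA hBc hAc (hsub A B hAB)
    rw [← setIntegral_swap] at this
    simpa [mul_comm, mul_left_comm] using this

/-- Fubini for a function supported in a box. -/
lemma setIntegral_eq_iterated {Ω : Set (ℝ × ℝ)} {a b c d : ℝ} (hab : a ≤ b) (hcd : c ≤ d)
    (hbox : Icc a b ×ˢ Icc c d ⊆ Ω) {G : ℝ × ℝ → ℝ} (hG : IntegrableOn G (Icc a b ×ˢ Icc c d))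
    (h0 : ∀ w, w ∉ Ioo a b ×ˢ Ioo c d → G w = 0) :
    ∫ w in Ω, G w = ∫ s in a..b, ∫ y in c..d, G (s, y) := by
  have hsub : Ioc a b ×ˢ Ioc c d ⊆ Icc a b ×ˢ Icc c d :=
    prod_mono Ioc_subset_Icc_self Ioc_subset_Icc_self
  have hsub' : Ioo a b ×ˢ Ioo c d ⊆ Ioc a b ×ˢ Ioc c d :=
    prod_mono Ioo_subset_Ioc_self Ioo_subset_Ioc_self
  rw [setIntegral_eq_integral_of_forall_compl_eq_zero
      (fun w hw => h0 w fun hw' => hw (hbox (hsub (hsub' hw')))),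
    ← setIntegral_eq_integral_of_forall_compl_eq_zero (s := Ioc a b ×ˢ Ioc c d)
      (fun w hw => h0 w fun hw' => hw (hsub' hw')),
    intervalIntegral.integral_of_le hab]
  rw [Measure.volume_eq_prod, setIntegral_prod]
  · simp only [intervalIntegral.integral_of_le hcd]
  · exact hG.mono_set hsub

/-- Continuity of an integral depending on a parameter, on a box. -/
lemma continuousOn_integral_box {a b c d : ℝ} (hab : a ≤ b) (hcd : c ≤ d) {G : ℝ × ℝ → ℝ}
    (hG : ContinuousOn G (Icc a b ×ˢ Icc c d)) :
    ContinuousOn (fun s => ∫ y in c..d, G (s, y)) (Icc a b) := by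
  -- Clamping both coordinates to the box extends the integrand continuously to the plane.
  let H : ℝ → ℝ → ℝ := fun s y => G (projIcc a b hab s, projIcc c d hcd y)
  have hH : Continuous (Function.uncurry H) := by
    refine hG.comp_continuous (f := fun w : ℝ × ℝ => ((projIcc a b hab w.1 : ℝ),
      (projIcc c d hcd w.2 : ℝ))) ?_ fun w => ⟨(projIcc a b hab w.1).2, (projIcc c d hcd w.2).2⟩
    exact ((continuous_subtype_val.comp continuous_projIcc).comp continuous_fst).prodMk
      ((continuous_subtype_val.comp continuous_projIcc).comp continuous_snd)
  refine ContinuousOn.congr (f := fun s => ∫ y in c..d, H s y) ?_ ?_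
  · exact (intervalIntegral.continuous_parametric_intervalIntegral_of_continuous' hH c d).continuousOn
  · intro s hs
    apply intervalIntegral.integral_congr
    intro y hy
    rw [uIcc_of_le hcd] at hy
    simp [H, projIcc_of_mem _ hs, projIcc_of_mem _ hy]

section CharSystem

variable {Ω : Set (ℝ × ℝ)} {U R S : ℝ × ℝ → ℝ}

lemma hasCompactSupport_of_subset_Ioo {A : ℝ → ℝ} {a b : ℝ} (h : tsupport A ⊆ Ioo a b) :
    HasCompactSupport A :=
  isCompact_Icc.of_isClosed_subset (isClosed_tsupport A) (h.trans Ioo_subset_Icc_self)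

lemma tsupport_prod_subset {A B : ℝ → ℝ} {a b c d : ℝ} (hbox : Icc a b ×ˢ Icc c d ⊆ Ω)
    (hA : tsupport A ⊆ Ioo a b) (hB : tsupport B ⊆ Ioo c d) : tsupport A ×ˢ tsupport B ⊆ Ω :=
  (prod_mono (hA.trans Ioo_subset_Icc_self) (hB.trans Ioo_subset_Icc_self)).trans hbox

lemma mul_eq_zero_of_notMem_prod {A B : ℝ → ℝ} {a b c d : ℝ} (Q : ℝ × ℝ → ℝ)
    (hA : tsupport A ⊆ Ioo a b) (hB : tsupport B ⊆ Ioo c d) :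
    ∀ w : ℝ × ℝ, w ∉ Ioo a b ×ˢ Ioo c d → Q w * (A w.1 * B w.2) = 0 := by
  intro w hw
  rw [mem_prod, not_and_or] at hw
  rcases hw with hw | hw
  · rw [image_eq_zero_of_notMem_tsupport fun h => hw (hA h)]; simp
  · rw [image_eq_zero_of_notMem_tsupport fun h => hw (hB h)]; simp

lemma tsupport_deriv_subset_Ioo {A : ℝ → ℝ} {a b : ℝ} (h : tsupport A ⊆ Ioo a b) :
    tsupport (deriv A) ⊆ Ioo a b :=
  tsupport_deriv_subset.trans h

/-- An integral over `Ω` against a product test function as an iterated integral. -/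
lemma setIntegral_tensor {a b c d : ℝ} (hab : a ≤ b) (hcd : c ≤ d)
    (hbox : Icc a b ×ˢ Icc c d ⊆ Ω) {Q : ℝ × ℝ → ℝ} (hQ : IntegrableOn Q (Icc a b ×ˢ Icc c d))
    {A B : ℝ → ℝ} (hA : Continuous A) (hB : Continuous B)
    (hAs : tsupport A ⊆ Ioo a b) (hBs : tsupport B ⊆ Ioo c d) :
    ∫ w in Ω, Q w * (A w.1 * B w.2) = ∫ s in a..b, (∫ y in c..d, Q (s, y) * B y) * A s := by
  rw [setIntegral_eq_iterated hab hcd hbox ?_ (mul_eq_zero_of_notMem_prod Q hAs hBs)]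
  · congr 1
    ext s
    rw [← intervalIntegral.integral_mul_const]
    congr 1
    ext y
    ring
  · apply hQ.mul_continuousOn _ (isCompact_Icc.prod isCompact_Icc)
    fun_prop

lemma CharSystem.integrableOn_box (h : CharSystem Ω U R S) {a b c d : ℝ}
    (hbox : Icc a b ×ˢ Icc c d ⊆ Ω) : IntegrableOn U (Icc a b ×ˢ Icc c d) :=
  (h.cont.mono hbox).integrableOn_compact (isCompact_Icc.prod isCompact_Icc)

/-- `U` satisfies the parallelogram identity on boxes contained in `Ω`. -/
lemma CharSystem.parallelogram_box (h : CharSystem Ω U R S) {a b c d : ℝ} (hab : a < b)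
    (hcd : c < d) (hbox : Icc a b ×ˢ Icc c d ⊆ Ω) {s₁ s₂ y₁ y₂ : ℝ} (hs1 : s₁ ∈ Icc a b)
    (hs2 : s₂ ∈ Icc a b) (hy1 : y₁ ∈ Icc c d) (hy2 : y₂ ∈ Icc c d) :
    U (s₁, y₁) - U (s₂, y₁) = U (s₁, y₂) - U (s₂, y₂) := by
  have hUc : ContinuousOn U (Icc a b ×ˢ Icc c d) := h.cont.mono hbox
  have hslice : ∀ s ∈ Icc a b, ContinuousOn (fun y => U (s, y)) (Icc c d) := fun s hs =>
    hUc.comp (by fun_prop) fun y hy => ⟨hs, hy⟩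
  have hslice' : ∀ s ∈ Icc a b, ∀ B : ℝ → ℝ, Continuous B →
      IntervalIntegrable (fun y => U (s, y) * B y) volume c d := by
    intro s hs B hB
    apply ContinuousOn.intervalIntegrable
    rw [uIcc_of_le hcd.le]
    exact (hslice s hs).mul hB.continuousOn
  -- Du Bois-Reymond is used twice with zero derivative: in `s` for the pairing of `U (s, ·)` with
  -- `deriv B`, where `weakRS` applies, and then in `y` for the difference of two slices.
  have key := sub_eq_integral_of_weak_deriv (f := fun _ => (0 : ℝ))
    (V := fun y => U (s₁, y) - U (s₂, y)) hcd ((hslice s₁ hs1).sub (hslice s₂ hs2))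
    (by simp) (fun B hB hBs => ?_) hy1 hy2
  · simpa [sub_eq_zero] using key
  · have hB' : Continuous (deriv B) := hB.continuous_deriv (by simp)
    have key2 := sub_eq_integral_of_weak_deriv (f := fun _ => (0 : ℝ))
      (V := fun s => ∫ y in c..d, U (s, y) * deriv B y) hab
      (continuousOn_integral_box hab.le hcd.le (G := fun w => U w * deriv B w.2)
        (hUc.mul (by fun_prop)))
      (by simp) (fun A hA hAs => ?_) hs1 hs2
    · have : ∀ y, (U (s₁, y) - U (s₂, y)) * deriv B y
          = U (s₁, y) * deriv B y - U (s₂, y) * deriv B y := fun y => by ring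
      simp only [this]
      rw [intervalIntegral.integral_sub (hslice' s₁ hs1 _ hB') (hslice' s₂ hs2 _ hB'), key2]
      simp
    · rw [← setIntegral_tensor hab.le hcd.le hbox (h.integrableOn_box hbox)
        (hA.continuous_deriv (by simp)) hB' (tsupport_deriv_subset_Ioo hAs)
        (tsupport_deriv_subset_Ioo hBs),
        h.weakRS A B hA hB (hasCompactSupport_of_subset_Ioo hAs)
        (hasCompactSupport_of_subset_Ioo hBs) (tsupport_prod_subset hbox hAs hBs)]
      simp

/-- `U` satisfies the parallelogram identity. -/
lemma CharSystem.parallelogram (h : CharSystem Ω U R S) {s₁ s₂ y₁ y₂ : ℝ}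
    (h11 : (s₁, y₁) ∈ Ω) (h21 : (s₂, y₁) ∈ Ω) (h12 : (s₁, y₂) ∈ Ω) (h22 : (s₂, y₂) ∈ Ω) :
    U (s₁, y₁) - U (s₂, y₁) = U (s₁, y₂) - U (s₂, y₂) := by
  rcases eq_or_ne s₁ s₂ with rfl | hs
  · simp
  rcases eq_or_ne y₁ y₂ with rfl | hy
  · rfl
  have hbox : Icc (min s₁ s₂) (max s₁ s₂) ×ˢ Icc (min y₁ y₂) (max y₁ y₂) ⊆ Ω := by
    apply box_subset_of_convex h.convex <;>
    · rcases le_total s₁ s₂ with h1 | h1 <;> rcases le_total y₁ y₂ with h2 | h2 <;> simp [*]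
  exact h.parallelogram_box (min_lt_max.2 hs) (min_lt_max.2 hy) hbox
    ⟨min_le_left _ _, le_max_left _ _⟩ ⟨min_le_right _ _, le_max_right _ _⟩
    ⟨min_le_left _ _, le_max_left _ _⟩ ⟨min_le_right _ _, le_max_right _ _⟩

/-- On a box, `U` is absolutely continuous in the first variable with square integrable
derivative. -/
lemma CharSystem.exists_deriv_box (h : CharSystem Ω U R S) {a b c d : ℝ} (hab : a < b)
    (hcd : c < d) (hbox : Icc a b ×ˢ Icc c d ⊆ Ω) :
    ∃ f : ℝ → ℝ, IntervalIntegrable f volume a b ∧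
      IntervalIntegrable (fun s => f s ^ 2) volume a b ∧
      ∀ s₁ ∈ Icc a b, ∀ s₂ ∈ Icc a b, ∀ y ∈ Icc c d,
        U (s₁, y) - U (s₂, y) = ∫ s in s₂..s₁, f s := by
  obtain ⟨B, hB, hBs, hB1⟩ := exists_test_integral_one hcd
  have hUc : ContinuousOn U (Icc a b ×ˢ Icc c d) := h.cont.mono hbox
  have hK : IsCompact (Icc a b ×ˢ Icc c d) := isCompact_Icc.prod isCompact_Icc
  have hBc := hB.continuous
  have hR2 := h.memR _ hbox hK
  have : IsFiniteMeasure (volume.restrict (Icc a b ×ˢ Icc c d)) :=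
    ⟨by simpa using hK.measure_lt_top⟩
  have hR : IntegrableOn R (Icc a b ×ˢ Icc c d) := hR2.integrable (by norm_num)
  have hRsq : IntegrableOn (fun w => R w ^ 2) (Icc a b ×ˢ Icc c d) := hR2.integrable_sq
  have hRB : IntegrableOn (fun w => R w * B w.2) (Icc a b ×ˢ Icc c d) :=
    hR.mul_continuousOn (by fun_prop) hK
  have hsub : Ioc a b ×ˢ Ioc c d ⊆ Icc a b ×ˢ Icc c d :=
    prod_mono Ioc_subset_Icc_self Ioc_subset_Icc_self
  have hRB' : Integrable (fun w : ℝ × ℝ => R w * B w.2)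
      ((volume.restrict (Ioc a b)).prod (volume.restrict (Ioc c d))) := by
    rw [Measure.prod_restrict]; exact hRB.mono_set hsub
  have hRsq' : Integrable (fun w : ℝ × ℝ => R w ^ 2)
      ((volume.restrict (Ioc a b)).prod (volume.restrict (Ioc c d))) := by
    rw [Measure.prod_restrict]; exact hRsq.mono_set hsub
  -- The derivative is the average of `R` over the second variable against a test function of
  -- integral one; Cauchy-Schwarz bounds its square by the slice integrals of `R ^ 2`.
  set f : ℝ → ℝ := fun s => ∫ y in c..d, R (s, y) * B y with hf
  have hfint : IntervalIntegrable f volume a b := by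
    rw [intervalIntegrable_iff_integrableOn_Ioc_of_le hab.le]
    have := hRB'.integral_prod_left
    simpa only [hf, intervalIntegral.integral_of_le hcd.le] using! this
  refine ⟨f, hfint, ?_, ?_⟩
  · rw [intervalIntegrable_iff_integrableOn_Ioc_of_le hab.le]
    have hdom : Integrable (fun s => (∫ y in c..d, B y ^ 2) * ∫ y in c..d, R (s, y) ^ 2)
        (volume.restrict (Ioc a b)) := by
      have := hRsq'.integral_prod_left
      simp only [← intervalIntegral.integral_of_le hcd.le] at this
      exact this.const_mul _
    refine Integrable.mono' hdom ?_ ?_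
    · rw [intervalIntegrable_iff_integrableOn_Ioc_of_le hab.le] at hfint
      exact hfint.aestronglyMeasurable.pow 2
    · filter_upwards [hRB'.prod_right_ae, hRsq'.prod_right_ae] with s hs1 hs2
      rw [Real.norm_of_nonneg (sq_nonneg _)]
      apply sq_integral_mul_le hcd.le
      · rw [intervalIntegrable_iff_integrableOn_Ioc_of_le hcd.le]; exact hs2
      · rw [intervalIntegrable_iff_integrableOn_Ioc_of_le hcd.le]; exact hs1
      · exact (hBc.pow 2).intervalIntegrable _ _
  · intro s₁ hs1 s₂ hs2 y hy
    have key := sub_eq_integral_of_weak_deriv (V := fun s => ∫ y in c..d, U (s, y) * B y) hab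
      (continuousOn_integral_box hab.le hcd.le (G := fun w => U w * B w.2)
        (hUc.mul (by fun_prop))) hfint (fun A hA hAs => ?_) hs1 hs2
    · rw [← key]
      have hsl : ∀ s ∈ Icc a b, IntervalIntegrable (fun y => U (s, y) * B y) volume c d := by
        intro s hs
        apply ContinuousOn.intervalIntegrable
        rw [uIcc_of_le hcd.le]
        exact (hUc.comp (by fun_prop) fun y hy => ⟨hs, hy⟩ :
          ContinuousOn (fun y => U (s, y)) (Icc c d)).mul hBc.continuousOn
      rw [← intervalIntegral.integral_sub (hsl s₁ hs1) (hsl s₂ hs2)]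
      -- By the parallelogram identity the increment of `U` is the same on every slice, so averaging
      -- against `B` recovers it.
      have : ∫ y' in c..d, (U (s₁, y') * B y' - U (s₂, y') * B y')
          = ∫ y' in c..d, (U (s₁, y) - U (s₂, y)) * B y' := by
        apply intervalIntegral.integral_congr
        intro y' hy'
        rw [uIcc_of_le hcd.le] at hy'
        simp only
        rw [h.parallelogram_box hab hcd hbox hs1 hs2 hy hy']
        ring
      rw [this, intervalIntegral.integral_const_mul, hB1, mul_one]
    · have := h.weakR A B hA hB (hasCompactSupport_of_subset_Ioo hAs)
        (hasCompactSupport_of_subset_Ioo hBs) (tsupport_prod_subset hbox hAs hBs)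
      rw [setIntegral_tensor hab.le hcd.le hbox (h.integrableOn_box hbox)
          (hA.continuous_deriv (by simp)) hBc (tsupport_deriv_subset_Ioo hAs) hBs,
        setIntegral_tensor hab.le hcd.le hbox hR hA.continuous hBc hAs hBs] at this
      exact this

/-- A segment in the first direction inside `Ω` lies in the interior of a box inside `Ω`. -/
lemma CharSystem.exists_box (h : CharSystem Ω U R S) {s₁ s₂ y : ℝ}
    (h1 : (s₁, y) ∈ Ω) (h2 : (s₂, y) ∈ Ω) :
    ∃ ε > 0, Icc (s₁ - ε) (s₂ + ε) ×ˢ Icc (y - ε) (y + ε) ⊆ Ω := by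
  obtain ⟨ε1, hε1, hb1⟩ := Metric.isOpen_iff.1 h.isOpen _ h1
  obtain ⟨ε2, hε2, hb2⟩ := Metric.isOpen_iff.1 h.isOpen _ h2
  obtain ⟨ε, hpos, hle1, hle2⟩ : ∃ ε : ℝ, 0 < ε ∧ ε < ε1 ∧ ε < ε2 := by
    obtain ⟨ε, h1, h2⟩ := exists_between (lt_min hε1 hε2)
    exact ⟨ε, h1, lt_min_iff.1 h2⟩
  refine ⟨ε, hpos, box_subset_of_convex h.convex (hb1 ?_) (hb2 ?_) (hb1 ?_) (hb2 ?_)⟩ <;>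
    simp [Prod.dist_eq, abs_of_pos, *]

/-- `U` is absolutely continuous in the first variable, with a locally square integrable
derivative which does not depend on the second variable. -/
theorem CharSystem.exists_deriv (h : CharSystem Ω U R S) :
    ∃ f : ℝ → ℝ, ∀ s₁ s₂ y : ℝ, s₁ ≤ s₂ → (s₁, y) ∈ Ω → (s₂, y) ∈ Ω →
      ∃ ε > 0, IntervalIntegrable f volume (s₁ - ε) (s₂ + ε) ∧
        IntervalIntegrable (fun s => f s ^ 2) volume (s₁ - ε) (s₂ + ε) ∧
        ∀ x₁ ∈ Icc (s₁ - ε) (s₂ + ε), ∀ x₂ ∈ Icc (s₁ - ε) (s₂ + ε), ∀ z ∈ Icc (y - ε) (y + ε),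
        (x₁, z) ∈ Ω ∧ U (x₁, z) - U (x₂, z) = ∫ s in x₂..x₁, f s := by
  classical
  -- The box lemma gives a different derivative for each box. A single global one is obtained by
  -- differentiating `U` classically along a chosen slice through each `s`; by the parallelogram
  -- identity it agrees almost everywhere with every local one.
  let c : ℝ → ℝ := fun s => if hs : ∃ y, (s, y) ∈ Ω then hs.choose else 0
  have hc : ∀ s y, (s, y) ∈ Ω → (s, c s) ∈ Ω := by
    intro s y hs
    have hs' : ∃ y, (s, y) ∈ Ω := ⟨y, hs⟩
    simp only [c, dif_pos hs']
    exact hs'.choose_spec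
  refine ⟨fun s => deriv (fun x => U (x, c s)) s, fun s₁ s₂ y hs h1 h2 => ?_⟩
  obtain ⟨ε, hε, hbox⟩ := h.exists_box h1 h2
  have hlt : s₁ - ε < s₂ + ε := by linarith
  obtain ⟨f, hf, hf2, hfU⟩ := h.exists_deriv_box hlt (by linarith : y - ε < y + ε) hbox
  have hym : y ∈ Icc (y - ε) (y + ε) := ⟨by linarith, by linarith⟩
  have hae : ∀ᵐ s, s ∈ uIoc (s₁ - ε) (s₂ + ε) → deriv (fun x => U (x, c s)) s = f s := by
    have hne : ∀ᵐ s : ℝ, s ≠ s₂ + ε := by simp [ae_iff, measure_singleton]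
    filter_upwards [hf.ae_hasDerivAt_integral, hne] with s hs hsne hsm
    have hsI : s ∈ Icc (s₁ - ε) (s₂ + ε) := by
      rw [uIoc_of_le hlt.le] at hsm; exact Ioc_subset_Icc_self hsm
    have hd := hs (uIoc_subset_uIcc hsm) s (uIoc_subset_uIcc hsm)
    have hsΩ : (s, y) ∈ Ω := hbox ⟨hsI, hym⟩
    have hnhds : ∀ᶠ x in nhds s, U (x, c s) = U (s, c s) + ∫ r in s..x, f r := by
      have e1 : ∀ᶠ x in nhds s, (x, c s) ∈ Ω :=
        (by fun_prop : Continuous fun x : ℝ => (x, c s)).continuousAt.preimage_mem_nhds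
          (h.isOpen.mem_nhds (hc s y hsΩ))
      have e2 : ∀ᶠ x in nhds s, x ∈ Icc (s₁ - ε) (s₂ + ε) := by
        rw [uIoc_of_le hlt.le] at hsm
        exact Icc_mem_nhds hsm.1 (lt_of_le_of_ne hsm.2 hsne)
      filter_upwards [e1, e2] with x hx1 hx2
      rw [← hfU x hx2 s hsI y hym,
        h.parallelogram (hbox ⟨hx2, hym⟩) hsΩ hx1 (hc s y hsΩ)]
      ring
    have hd2 : HasDerivAt (fun x => U (s, c s) + ∫ r in s..x, f r) (f s) s := hd.const_add _
    exact (hd2.congr_of_eventuallyEq hnhds).deriv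
  refine ⟨ε, hε, ?_, ?_, ?_⟩
  · refine hf.congr_ae ?_
    rw [Filter.EventuallyEq, ae_restrict_iff' measurableSet_uIoc]
    filter_upwards [hae] with s hs hsm using (hs hsm).symm
  · refine hf2.congr_ae ?_
    rw [Filter.EventuallyEq, ae_restrict_iff' measurableSet_uIoc]
    filter_upwards [hae] with s hs hsm
    simp only [hs hsm]
  · intro x₁ hx1 x₂ hx2 z hz
    refine ⟨hbox ⟨hx1, hz⟩, ?_⟩
    rw [hfU x₁ hx1 x₂ hx2 z hz]
    apply intervalIntegral.integral_congr_ae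
    filter_upwards [hae] with s hs hsm
    refine (hs ?_).symm
    rw [uIoc_of_le hlt.le]
    exact ⟨lt_of_le_of_lt (le_min hx2.1 hx1.1) hsm.1, hsm.2.trans (max_le hx2.2 hx1.2)⟩

end CharSystem

lemma locallyIntegrableOn_of_interval {I : Set ℝ} {f : ℝ → ℝ}
    (h : ∀ s ∈ I, ∃ ε > 0, IntervalIntegrable f volume (s - ε) (s + ε)) :
    LocallyIntegrableOn f I := by
  intro s hs
  obtain ⟨ε, hε, hf⟩ := h s hs
  rw [intervalIntegrable_iff_integrableOn_Icc_of_le (by linarith)] at hf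
  exact ⟨_, mem_nhdsWithin_of_mem_nhds (Icc_mem_nhds (by linarith) (by linarith)), hf⟩

lemma intervalIntegrable_of_locallyIntegrableOn {I : Set ℝ} [I.OrdConnected] {f : ℝ → ℝ}
    (hf : LocallyIntegrableOn f I) {a b : ℝ} (ha : a ∈ I) (hb : b ∈ I) :
    IntervalIntegrable f volume a b := by
  rw [intervalIntegrable_iff]
  exact (hf.integrableOn_compact_subset (OrdConnected.uIcc_subset ‹_› ha hb)
    isCompact_uIcc).mono_set uIoc_subset_uIcc

/-- D'Alembert's formula: `U` is the sum of a function of the first coordinate and one of the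
second, both locally absolutely continuous with locally square integrable derivatives. -/
theorem CharSystem.dalembert {Ω : Set (ℝ × ℝ)} {U R S : ℝ × ℝ → ℝ} (h : CharSystem Ω U R S)
    {s₀ y₀ : ℝ} (h0 : (s₀, y₀) ∈ Ω) :
    ∃ f g : ℝ → ℝ,
      LocallyIntegrableOn f (Prod.fst '' Ω) ∧
      LocallyIntegrableOn (fun s => f s ^ 2) (Prod.fst '' Ω) ∧
      LocallyIntegrableOn g (Prod.snd '' Ω) ∧
      LocallyIntegrableOn (fun s => g s ^ 2) (Prod.snd '' Ω) ∧
      ∀ w ∈ Ω, U w = U (s₀, y₀) + (∫ s in s₀..w.1, f s) + ∫ y in y₀..w.2, g y := by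
  obtain ⟨f, hf⟩ := h.exists_deriv
  obtain ⟨g, hg⟩ := h.swap.exists_deriv
  have hfl : LocallyIntegrableOn f (Prod.fst '' Ω) := locallyIntegrableOn_of_interval (by
    rintro _ ⟨⟨s, y⟩, hw, rfl⟩
    obtain ⟨ε, hε, h1, -⟩ := hf s s y le_rfl hw hw
    exact ⟨ε, hε, h1⟩)
  have hgl : LocallyIntegrableOn g (Prod.snd '' Ω) := locallyIntegrableOn_of_interval (by
    rintro _ ⟨⟨s, y⟩, hw, rfl⟩
    obtain ⟨ε, hε, h1, -⟩ := hg y y s le_rfl hw hw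
    exact ⟨ε, hε, h1⟩)
  refine ⟨f, g, hfl, ?_, hgl, ?_, ?_⟩
  · apply locallyIntegrableOn_of_interval
    rintro _ ⟨⟨s, y⟩, hw, rfl⟩
    obtain ⟨ε, hε, -, h1, -⟩ := hf s s y le_rfl hw hw
    exact ⟨ε, hε, h1⟩
  · apply locallyIntegrableOn_of_interval
    rintro _ ⟨⟨s, y⟩, hw, rfl⟩
    obtain ⟨ε, hε, -, h1, -⟩ := hg y y s le_rfl hw hw
    exact ⟨ε, hε, h1⟩
  have hI : (Prod.fst '' Ω).OrdConnected :=
    (h.convex.is_linear_image ⟨fun _ _ => rfl, fun _ _ => rfl⟩).ordConnected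
  have hJ : (Prod.snd '' Ω).OrdConnected :=
    (h.convex.is_linear_image ⟨fun _ _ => rfl, fun _ _ => rfl⟩).ordConnected
  have hfi : ∀ {w w' : ℝ × ℝ}, w ∈ Ω → w' ∈ Ω → IntervalIntegrable f volume w.1 w'.1 :=
    fun hw hw' => intervalIntegrable_of_locallyIntegrableOn hfl (mem_image_of_mem _ hw)
      (mem_image_of_mem _ hw')
  have hgi : ∀ {w w' : ℝ × ℝ}, w ∈ Ω → w' ∈ Ω → IntervalIntegrable g volume w.2 w'.2 :=
    fun hw hw' => intervalIntegrable_of_locallyIntegrableOn hgl (mem_image_of_mem _ hw)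
      (mem_image_of_mem _ hw')
  -- The remainder after removing both primitives is locally constant, hence constant on the convex
  -- set `Ω`.
  set K : ℝ × ℝ → ℝ := fun w => U w - (∫ s in s₀..w.1, f s) - ∫ y in y₀..w.2, g y with hK
  have hloc : ∀ w ∈ Ω, K =ᶠ[nhds w] fun _ => K w := by
    rintro ⟨s, y⟩ hw
    obtain ⟨ε, hε, -, -, h1⟩ := hf s s y le_rfl hw hw
    obtain ⟨δ, hδ, -, -, h2⟩ := hg y y s le_rfl hw hw
    have hn : Icc (s - ε) (s + ε) ×ˢ (Icc (y - ε) (y + ε) ∩ Icc (y - δ) (y + δ)) ∈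
        nhds (s, y) :=
      prod_mem_nhds (Icc_mem_nhds (by linarith) (by linarith)) (Filter.inter_mem
        (Icc_mem_nhds (by linarith) (by linarith)) (Icc_mem_nhds (by linarith) (by linarith)))
    filter_upwards [hn] with ⟨x, z⟩ ⟨hx, hz, hz'⟩
    obtain ⟨hm, e1⟩ := h1 x hx s ⟨by linarith, by linarith⟩ z hz
    obtain ⟨-, e2⟩ := h2 z hz' y ⟨by linarith, by linarith⟩ s ⟨by linarith, by linarith⟩
    have e3 := intervalIntegral.integral_add_adjacent_intervals (hfi h0 hw) (hfi hw hm)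
    have e4 := intervalIntegral.integral_add_adjacent_intervals (hgi h0 hw) (hgi hw hm)
    simp only [Function.comp, Prod.swap_prod_mk] at e2
    simp only [hK]
    dsimp only at e3 e4 hx hz
    linarith
  obtain ⟨c, hc⟩ := h.isOpen.exists_is_const_of_fderiv_eq_zero (𝕜 := ℝ) h.convex.isPreconnected
    (f := K) (fun w hw =>
      ((hasFDerivAt_const (K w) w).congr_of_eventuallyEq
        (hloc w hw)).differentiableAt.differentiableWithinAt)
    (fun w hw => ((hasFDerivAt_const (K w) w).congr_of_eventuallyEq (hloc w hw)).fderiv)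
  intro w hw
  have e1 := hc w hw
  have e2 := hc _ h0
  simp only [hK, intervalIntegral.integral_same] at e1 e2
  linarith

/-! ### From the wave equation to characteristic coordinates -/

/-- The change from characteristic coordinates `(t + x, t - x)` to `(x, t)`. -/
def charEquiv : (ℝ × ℝ) ≃L[ℝ] (ℝ × ℝ) :=
  LinearEquiv.toContinuousLinearEquiv
    { toFun := fun w => ((w.1 - w.2) / 2, (w.1 + w.2) / 2)
      map_add' := fun a b => by ext <;> simp <;> ring
      map_smul' := fun c a => by ext <;> simp <;> ring
      invFun := fun z => (z.2 + z.1, z.2 - z.1)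
      left_inv := fun w => by ext <;> simp <;> ring
      right_inv := fun z => by ext <;> simp }

lemma charEquiv_apply (w : ℝ × ℝ) : charEquiv w = ((w.1 - w.2) / 2, (w.1 + w.2) / 2) := rfl

lemma charEquiv_symm_apply (z : ℝ × ℝ) : charEquiv.symm z = (z.2 + z.1, z.2 - z.1) := rfl

/-- A linear bijection scales Lebesgue measure by a finite nonzero constant. Its value is
irrelevant, since the transported identities are homogeneous in the integrals. -/
lemma exists_map_charEquiv : ∃ C : ENNReal, C ≠ 0 ∧ C ≠ ⊤ ∧
    Measure.map charEquiv (volume : Measure (ℝ × ℝ)) = C • volume := by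
  have hdet : LinearMap.det (charEquiv.toLinearEquiv : (ℝ × ℝ) →ₗ[ℝ] (ℝ × ℝ)) ≠ 0 :=
    (LinearEquiv.isUnit_det' charEquiv.toLinearEquiv).ne_zero
  refine ⟨_, ?_, ENNReal.ofReal_ne_top, Measure.map_linearMap_addHaar_eq_smul_addHaar volume hdet⟩
  simp only [ne_eq, ENNReal.ofReal_eq_zero, not_le]
  positivity

lemma measurableEmbedding_charEquiv : MeasurableEmbedding charEquiv :=
  charEquiv.toHomeomorph.measurableEmbedding

/-- Change of variables in planar integrals. -/
lemma exists_setIntegral_charEquiv : ∃ c : ℝ, 0 < c ∧ ∀ (D : Set (ℝ × ℝ)) (G : ℝ × ℝ → ℝ),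
    c * ∫ z in D, G z = ∫ w in charEquiv ⁻¹' D, G (charEquiv w) := by
  obtain ⟨C, hC0, hC, hmap⟩ := exists_map_charEquiv
  refine ⟨C.toReal, ENNReal.toReal_pos hC0 hC, fun D G => ?_⟩
  rw [← measurableEmbedding_charEquiv.setIntegral_map, hmap, Measure.restrict_smul,
    integral_smul_measure, smul_eq_mul]

lemma memLp_comp_charEquiv {D K : Set (ℝ × ℝ)} {p : ℝ × ℝ → ℝ}
    (hp : MemLp p 2 (volume.restrict D)) (hK : K ⊆ charEquiv ⁻¹' D) :
    MemLp (p ∘ charEquiv) 2 (volume.restrict K) := by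
  obtain ⟨C, hC0, hC, hmap⟩ := exists_map_charEquiv
  have h1 : MemLp (p ∘ charEquiv) 2 (volume.restrict (charEquiv ⁻¹' D)) := by
    rw [← measurableEmbedding_charEquiv.memLp_map_measure_iff,
      ← measurableEmbedding_charEquiv.restrict_map, hmap, Measure.restrict_smul]
    exact hp.smul_measure hC
  exact h1.mono_measure (Measure.restrict_mono_set _ hK)

lemma isOpen_domain (k : ℝ) : IsOpen (domain k) := by
  simp only [domain, endpoint, ofPred_and]
  exact (isOpen_lt continuous_const continuous_fst).inter
    ((isOpen_lt continuous_fst (by fun_prop)).inter (isOpen_lt continuous_const continuous_snd))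

lemma convex_domain (k : ℝ) : Convex ℝ (domain k) := by
  rintro ⟨x, t⟩ ⟨h1, h2, h3⟩ ⟨x', t'⟩ ⟨h1', h2', h3'⟩ p q hp hq hpq
  simp only [endpoint] at h1 h2 h3 h1' h2' h3'
  have key : ∀ a b : ℝ, 0 < a → 0 < b → 0 < p * a + q * b := by
    intro a b ha hb
    rcases hp.eq_or_lt with rfl | hp
    · have : q = 1 := by linarith
      subst this; linarith
    · have := mul_pos hp ha
      have := mul_nonneg hq hb.le
      linarith
  refine ⟨?_, ?_, ?_⟩
  · simpa using key _ _ h1 h1'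
  · have := key _ _ (sub_pos.2 h2) (sub_pos.2 h2')
    simp only [endpoint, Prod.smul_mk, smul_eq_mul, Prod.mk_add_mk]
    have hq' : q = 1 - p := by linarith
    subst hq'
    linarith
  · simpa using key _ _ h3 h3'

lemma exists_subset_domainUpTo {k : ℝ} {K : Set (ℝ × ℝ)} (hK : IsCompact K) (hs : K ⊆ domain k) :
    ∃ T : ℝ, 0 < T ∧ K ⊆ domainUpTo k T := by
  obtain ⟨T, hT⟩ := (hK.image continuous_snd).bddAbove
  refine ⟨max T 0 + 1, by positivity, fun z hz => ⟨hs hz, ?_⟩⟩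
  have : z.2 ≤ T := hT (mem_image_of_mem _ hz)
  have := le_max_left T 0
  linarith

lemma integrable_mul_of_compact {X : Type*} [TopologicalSpace X] [T2Space X] [MeasurableSpace X]
    [OpensMeasurableSpace X] {μ : Measure X} {Q ψ : X → ℝ} {K : Set X} (hK : IsCompact K)
    (hQ : IntegrableOn Q K μ) (hψ : Continuous ψ) (h0 : ∀ z, z ∉ K → ψ z = 0) :
    Integrable (fun z => Q z * ψ z) μ := by
  have h1 : IntegrableOn (fun z => Q z * ψ z) K μ := hQ.mul_continuousOn hψ.continuousOn hK
  rw [integrableOn_iff_integrable_of_support_subset] at h1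
  · exact h1
  · intro z hz
    by_contra hzK
    exact hz (by simp [h0 z hzK])

section Tensor

variable {A B : ℝ → ℝ}

lemma pdx_tensor (hA : Differentiable ℝ A) (hB : Differentiable ℝ B) :
    pdx (fun z => A (z.2 + z.1) * B (z.2 - z.1)) =
      fun z => deriv A (z.2 + z.1) * B (z.2 - z.1) - A (z.2 + z.1) * deriv B (z.2 - z.1) := by
  ext z
  have h1 : HasDerivAt (fun x => A (z.2 + x)) (deriv A (z.2 + z.1)) z.1 := by
    exact (hA (z.2 + z.1)).hasDerivAt.comp_const_add z.2 z.1
  have h2 : HasDerivAt (fun x => B (z.2 - x)) (-deriv B (z.2 - z.1)) z.1 := by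
    exact (hB (z.2 - z.1)).hasDerivAt.comp_const_sub z.2 z.1
  have := (h1.mul h2).deriv
  simp only [pdx]
  refine Eq.trans this ?_
  ring

lemma pdt_tensor (hA : Differentiable ℝ A) (hB : Differentiable ℝ B) :
    pdt (fun z => A (z.2 + z.1) * B (z.2 - z.1)) =
      fun z => deriv A (z.2 + z.1) * B (z.2 - z.1) + A (z.2 + z.1) * deriv B (z.2 - z.1) := by
  ext z
  have h1 : HasDerivAt (fun t => A (t + z.1)) (deriv A (z.2 + z.1)) z.2 := by
    exact (hA (z.2 + z.1)).hasDerivAt.comp_add_const z.2 z.1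
  have h2 : HasDerivAt (fun t => B (t - z.1)) (deriv B (z.2 - z.1)) z.2 := by
    exact (hB (z.2 - z.1)).hasDerivAt.comp_sub_const z.2 z.1
  exact (h1.mul h2).deriv

/-- In the coordinates `t + x` and `t - x` the wave operator is four times the mixed second
derivative. This turns the distributional wave equation into `weakRS`. -/
lemma wave_tensor (hA : ContDiff ℝ ∞ A) (hB : ContDiff ℝ ∞ B) (z : ℝ × ℝ) :
    pdt (pdt fun z => A (z.2 + z.1) * B (z.2 - z.1)) z -
      pdx (pdx fun z => A (z.2 + z.1) * B (z.2 - z.1)) z =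
      4 * (deriv A (z.2 + z.1) * deriv B (z.2 - z.1)) := by
  have hA' := hA.differentiable (by simp)
  have hB' := hB.differentiable (by simp)
  have hdA : Differentiable ℝ (deriv A) :=
    (contDiff_infty_iff_deriv.1 hA).2.differentiable (by simp)
  have hdB : Differentiable ℝ (deriv B) :=
    (contDiff_infty_iff_deriv.1 hB).2.differentiable (by simp)
  rw [pdt_tensor hA' hB', pdx_tensor hA' hB']
  have a1 : ∀ x t, HasDerivAt (fun x => A (t + x)) (deriv A (t + x)) x := fun x t => by
    exact (hA' (t + x)).hasDerivAt.comp_const_add t x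
  have a2 : ∀ x t, HasDerivAt (fun t => A (t + x)) (deriv A (t + x)) t := fun x t => by
    exact (hA' (t + x)).hasDerivAt.comp_add_const t x
  have b1 : ∀ x t, HasDerivAt (fun x => B (t - x)) (-deriv B (t - x)) x := fun x t => by
    exact (hB' (t - x)).hasDerivAt.comp_const_sub t x
  have b2 : ∀ x t, HasDerivAt (fun t => B (t - x)) (deriv B (t - x)) t := fun x t => by
    exact (hB' (t - x)).hasDerivAt.comp_sub_const t x
  have c1 : ∀ x t, HasDerivAt (fun x => deriv A (t + x)) (deriv (deriv A) (t + x)) x :=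
    fun x t => by
      exact (hdA (t + x)).hasDerivAt.comp_const_add t x
  have c2 : ∀ x t, HasDerivAt (fun t => deriv A (t + x)) (deriv (deriv A) (t + x)) t :=
    fun x t => by
      exact (hdA (t + x)).hasDerivAt.comp_add_const t x
  have d1 : ∀ x t, HasDerivAt (fun x => deriv B (t - x)) (-deriv (deriv B) (t - x)) x :=
    fun x t => by
      exact (hdB (t - x)).hasDerivAt.comp_const_sub t x
  have d2 : ∀ x t, HasDerivAt (fun t => deriv B (t - x)) (deriv (deriv B) (t - x)) t :=
    fun x t => by
      exact (hdB (t - x)).hasDerivAt.comp_sub_const t x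
  have e1 := (((c2 z.1 z.2).mul (b2 z.1 z.2)).add ((a2 z.1 z.2).mul (d2 z.1 z.2))).deriv
  have e2 := (((c1 z.1 z.2).mul (b1 z.1 z.2)).sub ((a1 z.1 z.2).mul (d1 z.1 z.2))).deriv
  simp only [pdt, pdx]
  refine (congrArg₂ (· - ·) e1 e2).trans ?_
  ring

lemma isTestFunction_tensor {k : ℝ} (hA : ContDiff ℝ ∞ A) (hB : ContDiff ℝ ∞ B)
    (hAc : HasCompactSupport A) (hBc : HasCompactSupport B)
    (hs : tsupport A ×ˢ tsupport B ⊆ charEquiv ⁻¹' domain k) :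
    IsTestFunction (domain k) (fun z => A (z.2 + z.1) * B (z.2 - z.1)) ∧
    IsCompact (charEquiv '' (tsupport A ×ˢ tsupport B)) ∧
    charEquiv '' (tsupport A ×ˢ tsupport B) ⊆ domain k := by
  have hK : IsCompact (charEquiv '' (tsupport A ×ˢ tsupport B)) :=
    (hAc.isCompact.prod hBc.isCompact).image charEquiv.continuous
  have hKs : charEquiv '' (tsupport A ×ˢ tsupport B) ⊆ domain k := image_subset_iff.2 hs
  have hsub : tsupport (fun z : ℝ × ℝ => A (z.2 + z.1) * B (z.2 - z.1)) ⊆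
      charEquiv '' (tsupport A ×ˢ tsupport B) := by
    refine closure_minimal (fun z hz => ?_) hK.isClosed
    refine ⟨charEquiv.symm z, ?_, by simp⟩
    rw [charEquiv_symm_apply]
    exact ⟨subset_tsupport _ (left_ne_zero_of_mul hz), subset_tsupport _ (right_ne_zero_of_mul hz)⟩
  refine ⟨⟨?_, hK.of_isClosed_subset (isClosed_tsupport _) hsub, hsub.trans hKs⟩, hK, hKs⟩
  exact (hA.comp (contDiff_snd.add contDiff_fst)).mul (hB.comp (contDiff_snd.sub contDiff_fst))

end Tensor

/-- A weak solution in characteristic coordinates. -/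
theorem IsWeakSolution.exists_charSystem {k a : ℝ} {u₀ u₁ : ℝ → ℝ} {u : ℝ × ℝ → ℝ}
    (h : IsWeakSolution k a u₀ u₁ u) :
    ∃ R S, CharSystem (charEquiv ⁻¹' domain k) (u ∘ charEquiv) R S := by
  obtain ⟨hu, p, q, hpq, hweak⟩ := h.memH1loc
  obtain ⟨c, hc, hcv⟩ := exists_setIntegral_charEquiv
  have huD : ContinuousOn u (domain k) := hu.mono subset_closure
  have hmem : ∀ K : Set (ℝ × ℝ), IsCompact K → K ⊆ charEquiv ⁻¹' domain k →
      MemLp (p ∘ charEquiv) 2 (volume.restrict K) ∧ MemLp (q ∘ charEquiv) 2 (volume.restrict K) := by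
    intro K hK hKs
    obtain ⟨T, hT, hsub⟩ := exists_subset_domainUpTo (hK.image charEquiv.continuous)
      (image_subset_iff.2 hKs)
    exact ⟨memLp_comp_charEquiv (hpq T hT).1 (image_subset_iff.1 hsub),
      memLp_comp_charEquiv (hpq T hT).2 (image_subset_iff.1 hsub)⟩
  have hint : ∀ K : Set (ℝ × ℝ), IsCompact K → K ⊆ domain k →
      IntegrableOn u K ∧ IntegrableOn p K ∧ IntegrableOn q K := by
    intro K hK hKs
    obtain ⟨T, hT, hsub⟩ := exists_subset_domainUpTo hK hKs
    have : IsFiniteMeasure (volume.restrict K) := ⟨by simpa using hK.measure_lt_top⟩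
    exact ⟨(huD.mono hKs).integrableOn_compact hK,
      ((hpq T hT).1.mono_measure (Measure.restrict_mono_set _ hsub)).integrable (by norm_num),
      ((hpq T hT).2.mono_measure (Measure.restrict_mono_set _ hsub)).integrable (by norm_num)⟩
  -- The derivatives along `t + x` and `t - x` are half the sum and half the difference of those in
  -- `t` and `x`, whence `R = (q + p) / 2` and `S = (q - p) / 2`.
  have hw : ∀ A B : ℝ → ℝ, ContDiff ℝ ∞ A → ContDiff ℝ ∞ B → HasCompactSupport A →
      HasCompactSupport B → tsupport A ×ˢ tsupport B ⊆ charEquiv ⁻¹' domain k →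
      (∫ z in domain k, u z * (deriv A (z.2 + z.1) * B (z.2 - z.1)) =
        - ∫ z in domain k, (q z + p z) / 2 * (A (z.2 + z.1) * B (z.2 - z.1))) ∧
      (∫ z in domain k, u z * (A (z.2 + z.1) * deriv B (z.2 - z.1)) =
        - ∫ z in domain k, (q z - p z) / 2 * (A (z.2 + z.1) * B (z.2 - z.1))) := by
    intro A B hA hB hAc hBc hs
    obtain ⟨htest, hK, hKs⟩ := isTestFunction_tensor hA hB hAc hBc hs
    obtain ⟨hx, ht⟩ := hweak _ htest
    have hA' := hA.differentiable (by simp)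
    have hB' := hB.differentiable (by simp)
    have hdA : Continuous (deriv A) := hA.continuous_deriv (by simp)
    have hdB : Continuous (deriv B) := hB.continuous_deriv (by simp)
    have hAc' := hA.continuous
    have hBc' := hB.continuous
    rw [pdx_tensor hA' hB'] at hx
    rw [pdt_tensor hA' hB'] at ht
    obtain ⟨iu, ip, iq⟩ := hint _ hK hKs
    have hnot : ∀ z, z ∉ charEquiv '' (tsupport A ×ˢ tsupport B) →
        z.2 + z.1 ∉ tsupport A ∨ z.2 - z.1 ∉ tsupport B := by
      intro z hz
      by_contra hcon
      push Not at hcon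
      exact hz ⟨charEquiv.symm z, ⟨hcon.1, hcon.2⟩, by simp⟩
    have z1 : ∀ A' B' : ℝ → ℝ, tsupport A' ⊆ tsupport A → tsupport B' ⊆ tsupport B → ∀ z,
        z ∉ charEquiv '' (tsupport A ×ˢ tsupport B) → A' (z.2 + z.1) * B' (z.2 - z.1) = 0 := by
      intro A' B' h1 h2 z hz
      rcases hnot z hz with h | h
      · rw [image_eq_zero_of_notMem_tsupport fun h' => h (h1 h'), zero_mul]
      · rw [image_eq_zero_of_notMem_tsupport fun h' => h (h2 h'), mul_zero]
    have i1 := (integrable_mul_of_compact hK iu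
      (ψ := fun z => deriv A (z.2 + z.1) * B (z.2 - z.1)) (by fun_prop)
      (z1 _ _ tsupport_deriv_subset subset_rfl)).integrableOn (s := domain k)
    have i2 := (integrable_mul_of_compact hK iu
      (ψ := fun z => A (z.2 + z.1) * deriv B (z.2 - z.1)) (by fun_prop)
      (z1 _ _ subset_rfl tsupport_deriv_subset)).integrableOn (s := domain k)
    have i3 := (integrable_mul_of_compact hK ip
      (ψ := fun z => A (z.2 + z.1) * B (z.2 - z.1)) (by fun_prop)
      (z1 _ _ subset_rfl subset_rfl)).integrableOn (s := domain k)
    have i4 := (integrable_mul_of_compact hK iq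
      (ψ := fun z => A (z.2 + z.1) * B (z.2 - z.1)) (by fun_prop)
      (z1 _ _ subset_rfl subset_rfl)).integrableOn (s := domain k)
    have e1 : ∀ z : ℝ × ℝ, (q z + p z) / 2 * (A (z.2 + z.1) * B (z.2 - z.1)) =
        (1 / 2) * (q z * (A (z.2 + z.1) * B (z.2 - z.1)) +
          p z * (A (z.2 + z.1) * B (z.2 - z.1))) := fun z => by ring
    have e2 : ∀ z : ℝ × ℝ, (q z - p z) / 2 * (A (z.2 + z.1) * B (z.2 - z.1)) =
        (1 / 2) * (q z * (A (z.2 + z.1) * B (z.2 - z.1)) -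
          p z * (A (z.2 + z.1) * B (z.2 - z.1))) := fun z => by ring
    simp only [mul_add, mul_sub] at hx ht
    simp only [e1, e2]
    rw [integral_sub i1 i2] at hx
    rw [integral_add i1 i2] at ht
    rw [integral_const_mul, integral_const_mul, integral_add i4 i3, integral_sub i4 i3]
    constructor <;> linarith
  refine ⟨fun w => (q (charEquiv w) + p (charEquiv w)) / 2,
    fun w => (q (charEquiv w) - p (charEquiv w)) / 2,
    (isOpen_domain k).preimage charEquiv.continuous,
    (convex_domain k).linear_preimage charEquiv.toLinearMap,
    huD.comp charEquiv.continuous.continuousOn (mapsTo_preimage _ _), ?_, ?_, ?_, ?_, ?_⟩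
  · intro K hKs hK
    obtain ⟨h1, h2⟩ := hmem K hK hKs
    have := (h2.add h1).const_mul (1 / 2)
    refine this.congr_norm ?_ ?_
    · exact ((h2.add h1).aestronglyMeasurable.const_mul (1 / 2)).congr
        (Filter.Eventually.of_forall fun w => by simp; ring)
    · exact Filter.Eventually.of_forall fun w => by simp; ring_nf
  · intro K hKs hK
    obtain ⟨h1, h2⟩ := hmem K hK hKs
    have := (h2.sub h1).const_mul (1 / 2)
    refine this.congr_norm ?_ ?_
    · exact ((h2.sub h1).aestronglyMeasurable.const_mul (1 / 2)).congr
        (Filter.Eventually.of_forall fun w => by simp; ring)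
    · exact Filter.Eventually.of_forall fun w => by simp; ring_nf
  · intro A B hA hB hAc hBc hs
    have := congrArg (c * ·) (hw A B hA hB hAc hBc hs).1
    simp only [mul_neg, hcv] at this
    simpa [charEquiv_apply, ← add_div, ← sub_div] using this
  · intro A B hA hB hAc hBc hs
    have := congrArg (c * ·) (hw A B hA hB hAc hBc hs).2
    simp only [mul_neg, hcv] at this
    simpa [charEquiv_apply, ← add_div, ← sub_div] using this
  · intro A B hA hB hAc hBc hs
    obtain ⟨htest, hK, hKs⟩ := isTestFunction_tensor hA hB hAc hBc hs
    have hwave := h.wave _ htest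
    simp only [wave_tensor hA hB] at hwave
    have := congrArg (c / 4 * ·) hwave
    simp only [mul_zero] at this
    rw [← this, div_mul_eq_mul_div, hcv, ← integral_div]
    congr 1
    ext w
    simp only [Function.comp, charEquiv_apply]
    ring_nf

/-! ### D'Alembert's formula up to the boundary -/

/-- Almost everywhere statements pull back along affine maps. -/
lemma ae_comp_affine {P : ℝ → Prop} (h : ∀ᵐ s, P s) {c : ℝ} (hc : c ≠ 0) (d : ℝ) :
    ∀ᵐ t, P (c * t + d) := by
  have h1 : ∀ᵐ s, P (s + d) :=
    (measurePreserving_add_right volume d).quasiMeasurePreserving.ae h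
  rw [ae_iff] at h1 ⊢
  have := Real.volume_preimage_mul_left hc {s | ¬ P (s + d)}
  rw [h1, mul_zero] at this
  exact this

lemma ae_comp_const_add {P : ℝ → Prop} (h : ∀ᵐ s, P s) (t : ℝ) : ∀ᵐ x, P (t + x) := by
  simpa [add_comm] using ae_comp_affine h one_ne_zero t

lemma ae_comp_const_sub {P : ℝ → Prop} (h : ∀ᵐ s, P s) (t : ℝ) : ∀ᵐ x, P (t - x) := by
  filter_upwards [ae_comp_affine h (neg_ne_zero.2 one_ne_zero) t] with x hx
  rwa [neg_one_mul, neg_add_eq_sub] at hx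

/-- Lebesgue differentiation holds on each member of a countable exhaustion of `(r, ∞)` by compact
intervals containing the base point `c`, and countably many null sets are discarded. -/
lemma ae_hasDerivAt_primitive {r c : ℝ} (hc : r < c) {f : ℝ → ℝ}
    (hf : LocallyIntegrableOn f (Ioi r)) :
    ∀ᵐ s, r < s → HasDerivAt (fun x => ∫ y in c..x, f y) (f s) s := by
  have h : ∀ n : ℕ, ∀ᵐ s, s ∈ uIcc (r + (c - r) / (n + 1)) (c + n) →
      HasDerivAt (fun x => ∫ y in c..x, f y) (f s) s := by
    intro n
    have hpos : 0 < (c - r) / (n + 1) := div_pos (by linarith) (by positivity)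
    have hle : (c - r) / (n + 1) ≤ c - r := div_le_self (by linarith) (by simp)
    have hn : (0 : ℝ) ≤ n := Nat.cast_nonneg n
    have hi : IntervalIntegrable f volume (r + (c - r) / (n + 1)) (c + n) :=
      intervalIntegrable_of_locallyIntegrableOn hf (by simp [hpos]) (by simp; linarith)
    filter_upwards [hi.ae_hasDerivAt_integral] with s hs hsm
    refine hs hsm c ?_
    rw [uIcc_of_le (by linarith)]
    constructor <;> linarith
  filter_upwards [ae_all_iff.2 h] with s hs hrs
  obtain ⟨n, hn⟩ := exists_nat_gt ((c - r) / (s - r))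
  obtain ⟨m, hm⟩ := exists_nat_gt (s - c)
  have hsr : 0 < s - r := by linarith
  have hn' : (c - r) < n * (s - r) := (div_lt_iff₀ hsr).1 hn
  refine hs (max n m) ?_
  rw [mem_uIcc]
  left
  have hnm : (n : ℝ) ≤ (max n m : ℕ) := by exact_mod_cast le_max_left n m
  have hmm : (m : ℝ) ≤ (max n m : ℕ) := by exact_mod_cast le_max_right n m
  constructor
  · have : (c - r) / ((max n m : ℕ) + 1) ≤ s - r := by
      rw [div_le_iff₀ (by positivity)]
      nlinarith
    linarith
  · linarith

lemma continuousOn_primitive_Ioi {r c : ℝ} (hc : r < c) {f : ℝ → ℝ}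
    (hf : LocallyIntegrableOn f (Ioi r)) :
    ContinuousOn (fun x => ∫ y in c..x, f y) (Ioi r) := by
  intro s hs
  have hs' : r < s := hs
  set α := (r + min s c) / 2
  set β := max s c + 1
  have h1 : min s c ≤ s := min_le_left _ _
  have h2 : min s c ≤ c := min_le_right _ _
  have h3 : s ≤ max s c := le_max_left _ _
  have h4 : c ≤ max s c := le_max_right _ _
  have h5 : r < min s c := lt_min hs' hc
  have hα : r < α := by simp only [α]; linarith
  have hαs : α < s := by simp only [α]; linarith
  have hαc : α ≤ c := by simp only [α]; linarith
  have hβs : s < β := by simp only [β]; linarith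
  have hβc : c ≤ β := by simp only [β]; linarith
  have hi : IntervalIntegrable f volume α β :=
    intervalIntegrable_of_locallyIntegrableOn hf hα (by simp; linarith)
  have := intervalIntegral.continuousOn_primitive_interval' hi
    (a := c) (by rw [uIcc_of_le (by linarith)]; exact ⟨hαc, hβc⟩)
  rw [uIcc_of_le (by linarith)] at this
  exact ((this s ⟨hαs.le, hβs.le⟩).continuousAt (Icc_mem_nhds hαs hβs)).continuousWithinAt

/-- Each such point is approached along the segment towards the interior point `(1 / 2, 1)`. -/
lemma mem_closure_domain {k : ℝ} (hk : 0 < k) {x t : ℝ} (hx : 0 ≤ x) (hxt : x ≤ endpoint k t)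
    (ht : 0 ≤ t) : (x, t) ∈ closure (domain k) := by
  have hlim : Filter.Tendsto (fun ε : ℝ => ((1 - ε) * x + ε / 2, (1 - ε) * t + ε))
      (nhdsWithin 0 (Ioi 0)) (nhds (x, t)) := by
    have : Continuous (fun ε : ℝ => ((1 - ε) * x + ε / 2, (1 - ε) * t + ε)) := by fun_prop
    have := this.tendsto 0
    simp only [sub_zero, one_mul, zero_div, add_zero] at this
    exact this.mono_left nhdsWithin_le_nhds
  refine mem_closure_of_tendsto hlim ?_
  filter_upwards [Ioo_mem_nhdsGT (zero_lt_one' ℝ)] with ε hε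
  have h1 : 0 ≤ 1 - ε := by linarith [hε.2]
  have h2 := hε.1
  have h3 := mul_nonneg h1 hx
  have h4 := mul_nonneg h1 ht
  have h5 := mul_nonneg h1 (sub_nonneg.2 hxt)
  have h6 := mul_pos h2 hk
  simp only [endpoint] at h5
  refine ⟨by simp only; linarith, ?_, by simp only; linarith⟩
  simp only [endpoint]
  nlinarith

/-- The characteristic `t + x = s` meets the domain at `x = min s 1 / 2`: this is less than the
initial length and leaves a positive time. -/
lemma Ioi_subset_fst_image {k : ℝ} (hk : 0 < k) :
    Ioi 0 ⊆ Prod.fst '' (charEquiv ⁻¹' domain k) := by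
  intro s hs
  have hs' : 0 < s := hs
  refine ⟨charEquiv.symm (min s 1 / 2, s - min s 1 / 2), ?_, ?_⟩
  · have h1 : min s 1 ≤ s := min_le_left _ _
    have h2 : min s 1 ≤ 1 := min_le_right _ _
    have h3 : 0 < min s 1 := lt_min hs' one_pos
    have h4 : 0 < s - min s 1 / 2 := by linarith
    have h5 := mul_pos hk h4
    simp only [mem_preimage, ContinuousLinearEquiv.apply_symm_apply]
    refine ⟨by simp only; linarith, ?_, h4⟩
    simp only [endpoint]
    linarith
  · simp [charEquiv_symm_apply]

lemma Ioi_subset_snd_image {k : ℝ} (hk : 0 < k) :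
    Ioi (-1) ⊆ Prod.snd '' (charEquiv ⁻¹' domain k) := by
  intro y hy
  have hy' : -1 < y := hy
  refine ⟨charEquiv.symm ((1 - min y 0) / 2, y + (1 - min y 0) / 2), ?_, ?_⟩
  · have h1 : min y 0 ≤ 0 := min_le_right _ _
    have h2 : -1 < min y 0 := lt_min hy' (by norm_num)
    have h4 : 0 < y + (1 - min y 0) / 2 := by
      rcases le_total y 0 with h | h
      · rw [min_eq_left h]; linarith
      · rw [min_eq_right h]; linarith
    have h5 := mul_pos hk h4
    simp only [mem_preimage, ContinuousLinearEquiv.apply_symm_apply]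
    refine ⟨by simp only; linarith, ?_, h4⟩
    simp only [endpoint]
    linarith
  · simp [charEquiv_symm_apply]

/-- D'Alembert's formula for weak solutions, up to the boundary of the domain. -/
theorem IsWeakSolution.dalembert {k a : ℝ} (hk0 : 0 < k) (hk1 : k < 1) {u₀ u₁ : ℝ → ℝ}
    {u : ℝ × ℝ → ℝ} (h : IsWeakSolution k a u₀ u₁ u) :
    ∃ f g F G : ℝ → ℝ,
      (∀ᵐ s, 0 < s → HasDerivAt F (f s) s) ∧ (∀ᵐ s, -1 < s → HasDerivAt G (g s) s) ∧
      LocallyIntegrableOn (fun s => g s ^ 2) (Ioi (-1)) ∧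
      ∀ x t, 0 ≤ x → x ≤ endpoint k t → 0 ≤ t → 0 < t + x → -1 < t - x →
        u (x, t) = F (t + x) + G (t - x) := by
  obtain ⟨R, S, hS⟩ := h.exists_charSystem
  have h0 : ((3 / 2 : ℝ), (1 / 2 : ℝ)) ∈ charEquiv ⁻¹' domain k := by
    simp only [mem_preimage, charEquiv_apply, domain, endpoint]
    norm_num
    linarith
  obtain ⟨f, g, hf, -, hg, hg2, hU⟩ := hS.dalembert h0
  have hf' := hf.mono_set (Ioi_subset_fst_image hk0)
  have hg' := hg.mono_set (Ioi_subset_snd_image hk0)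
  set c := (u ∘ charEquiv) (3 / 2, 1 / 2)
  refine ⟨f, g, fun s => c + ∫ y in (3 / 2 : ℝ)..s, f y, fun s => ∫ y in (1 / 2 : ℝ)..s, g y,
    ?_, ae_hasDerivAt_primitive (by norm_num) hg', hg2.mono_set (Ioi_subset_snd_image hk0), ?_⟩
  · filter_upwards [ae_hasDerivAt_primitive (c := 3 / 2) (by norm_num) hf'] with s hs hs0
    exact (hs hs0).const_add c
  · have hsub : domain k ⊆ {z : ℝ × ℝ | 0 < z.2 + z.1 ∧ -1 < z.2 - z.1} := by
      rintro ⟨x, t⟩ ⟨h1, h2, h3⟩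
      have h4 := mul_pos (sub_pos.2 hk1) h3
      simp only [endpoint] at h1 h2 h3 h4
      constructor <;> dsimp only <;> linarith
    -- The formula holds in the open domain and both sides are continuous wherever the
    -- characteristic arguments stay in `(0, ∞)` and `(-1, ∞)`, so it extends to the boundary away
    -- from the corners `(0, 0)` and `(1, 0)`.
    have hEq : EqOn u (fun z => c + (∫ y in (3 / 2 : ℝ)..(z.2 + z.1), f y) +
          ∫ y in (1 / 2 : ℝ)..(z.2 - z.1), g y)
        (closure (domain k) ∩ {z : ℝ × ℝ | 0 < z.2 + z.1 ∧ -1 < z.2 - z.1}) := by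
      refine EqOn.of_subset_closure (s := domain k) ?_ (h.memH1loc.1.mono inter_subset_left) ?_
        (subset_inter subset_closure hsub) inter_subset_left
      · intro z hz
        have := hU (charEquiv.symm z) (by simpa using hz)
        rw [Function.comp_apply, charEquiv.apply_symm_apply] at this
        exact this
      · have c1 : ContinuousOn (fun z : ℝ × ℝ => ∫ y in (3 / 2 : ℝ)..(z.2 + z.1), f y)
            (closure (domain k) ∩ {z : ℝ × ℝ | 0 < z.2 + z.1 ∧ -1 < z.2 - z.1}) :=
          (continuousOn_primitive_Ioi (by norm_num) hf').comp (f := fun z : ℝ × ℝ => z.2 + z.1)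
            (by fun_prop) fun z hz => hz.2.1
        have c2 : ContinuousOn (fun z : ℝ × ℝ => ∫ y in (1 / 2 : ℝ)..(z.2 - z.1), g y)
            (closure (domain k) ∩ {z : ℝ × ℝ | 0 < z.2 + z.1 ∧ -1 < z.2 - z.1}) :=
          (continuousOn_primitive_Ioi (by norm_num) hg').comp (f := fun z : ℝ × ℝ => z.2 - z.1)
            (by fun_prop) fun z hz => hz.2.2
        exact (continuousOn_const.add c1).add c2
    intro x t h1 h2 h3 h4 h5
    exact hEq ⟨mem_closure_domain hk0 h1 h2 h3, h4, h5⟩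

lemma hasDerivAt_dalembert_x {F G : ℝ → ℝ} {f' g' x t : ℝ} (hF : HasDerivAt F f' (t + x))
    (hG : HasDerivAt G g' (t - x)) :
    HasDerivAt (fun y => F (t + y) + G (t - y)) (f' - g') x :=
  (hF.comp_const_add t x).add (hG.comp_const_sub t x)

lemma hasDerivAt_dalembert_t {F G : ℝ → ℝ} {f' g' x t : ℝ} (hF : HasDerivAt F f' (t + x))
    (hG : HasDerivAt G g' (t - x)) :
    HasDerivAt (fun s => F (s + x) + G (s - x)) (f' + g') t :=
  (hF.comp_add_const t x).add (hG.comp_sub_const t x)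

/-- `u` is given by d'Alembert's formula on the closed domain, except for the two corners. -/
def IsDalembert (k : ℝ) (u : ℝ × ℝ → ℝ) (F G : ℝ → ℝ) : Prop :=
  ∀ x t, 0 ≤ x → x ≤ endpoint k t → 0 ≤ t → 0 < t + x → -1 < t - x →
    u (x, t) = F (t + x) + G (t - x)

namespace IsDalembert

variable {k : ℝ} {u : ℝ × ℝ → ℝ} {F G : ℝ → ℝ} {f' g' x t : ℝ}

lemma hasDerivWithinAt_x (h : IsDalembert k u F G) (hx : 0 ≤ x) (hxt : x ≤ endpoint k t)
    (ht : 0 ≤ t) (hF : HasDerivAt F f' (t + x)) (hG : HasDerivAt G g' (t - x))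
    (h1 : 0 < t + x) (h2 : -1 < t - x) :
    HasDerivWithinAt (fun y => u (y, t)) (f' - g') (Icc 0 (endpoint k t)) x := by
  refine (hasDerivAt_dalembert_x hF hG).hasDerivWithinAt.congr_of_eventuallyEq ?_
    (h x t hx hxt ht h1 h2)
  have e1 : ∀ᶠ y in nhds x, 0 < t + y := by
    have : Continuous fun y : ℝ => t + y := by fun_prop
    exact this.continuousAt.eventually (lt_mem_nhds h1)
  have e2 : ∀ᶠ y in nhds x, -1 < t - y := by
    have : Continuous fun y : ℝ => t - y := by fun_prop
    exact this.continuousAt.eventually (lt_mem_nhds h2)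
  filter_upwards [self_mem_nhdsWithin, mem_nhdsWithin_of_mem_nhds e1,
    mem_nhdsWithin_of_mem_nhds e2] with y hy hy1 hy2
  exact h y t hy.1 hy.2 ht hy1 hy2

lemma hasDerivAt_x (h : IsDalembert k u F G) (hx : 0 < x) (hxt : x < endpoint k t)
    (ht : 0 ≤ t) (hF : HasDerivAt F f' (t + x)) (hG : HasDerivAt G g' (t - x))
    (h2 : -1 < t - x) :
    HasDerivAt (fun y => u (y, t)) (f' - g') x :=
  (h.hasDerivWithinAt_x hx.le hxt.le ht hF hG (by linarith) h2).hasDerivAt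
    (Icc_mem_nhds hx hxt)

/-- Because the right end recedes, the vertical ray above a point of the closed domain stays in it.
This gives the one-sided time derivative at the moving end itself. -/
lemma hasDerivWithinAt_t (h : IsDalembert k u F G) (hk : 0 < k) (hx : 0 ≤ x)
    (hxt : x ≤ endpoint k t) (ht : 0 ≤ t) (hF : HasDerivAt F f' (t + x))
    (hG : HasDerivAt G g' (t - x)) (h1 : 0 < t + x) (h2 : -1 < t - x) :
    HasDerivWithinAt (fun s => u (x, s)) (f' + g') (Ici t) t := by
  refine (hasDerivAt_dalembert_t hF hG).hasDerivWithinAt.congr_of_mem ?_ self_mem_Ici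
  intro s hs
  have hs' : t ≤ s := hs
  refine h x s hx (hxt.trans ?_) (by linarith) (by linarith) (by linarith)
  simp only [endpoint]
  nlinarith

/-- Away from the lateral boundary the formula holds at all nearby nonnegative times; this is the
time derivative appearing in `energyDensity` and in the initial condition. -/
lemma hasDerivWithinAt_t_Ici_zero (h : IsDalembert k u F G) (hx : 0 < x)
    (hxt : x < endpoint k t) (ht : 0 ≤ t) (hF : HasDerivAt F f' (t + x))
    (hG : HasDerivAt G g' (t - x)) (h2 : -1 < t - x) :
    HasDerivWithinAt (fun s => u (x, s)) (f' + g') (Ici 0) t := by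
  refine (hasDerivAt_dalembert_t hF hG).hasDerivWithinAt.congr_of_eventuallyEq ?_
    (h x t hx.le hxt.le ht (by linarith) h2)
  have e1 : ∀ᶠ s in nhds t, x < endpoint k s := by
    have : Continuous fun s : ℝ => endpoint k s := by unfold endpoint; fun_prop
    exact this.continuousAt.eventually (lt_mem_nhds hxt)
  have e2 : ∀ᶠ s in nhds t, -1 < s - x := by
    have : Continuous fun s : ℝ => s - x := by fun_prop
    exact this.continuousAt.eventually (lt_mem_nhds h2)
  filter_upwards [self_mem_nhdsWithin, mem_nhdsWithin_of_mem_nhds e1,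
    mem_nhdsWithin_of_mem_nhds e2] with s hs hs1 hs2
  have hs' : 0 ≤ s := hs
  exact h x s hx.le hs1.le hs (by linarith) hs2

end IsDalembert

/-! ### The profile of a weak solution -/

/-- The square of the derivative of the incoming profile is integrable up to the corner, because
of the initial data. -/
lemma IsWeakSolution.intervalIntegrable_sq {k a : ℝ} {u₀ u₁ : ℝ → ℝ}
    {u : ℝ × ℝ → ℝ} (h : IsWeakSolution k a u₀ u₁ u) {f g F G : ℝ → ℝ}
    (hF : ∀ᵐ s, 0 < s → HasDerivAt F (f s) s) (hG : ∀ᵐ s, -1 < s → HasDerivAt G (g s) s)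
    (hu : IsDalembert k u F G) : IntervalIntegrable (fun s => g s ^ 2) volume (-1) 0 := by
  obtain ⟨w, hw2, hw⟩ := h.data_pos
  have hwi : IntervalIntegrable w volume 0 1 := by
    rw [intervalIntegrable_iff_integrableOn_Ioo_of_le zero_le_one]
    exact hw2.integrable (by norm_num)
  have hv : IntervalIntegrable (fun x => ((u₁ x - w x) / 2) ^ 2) volume 0 1 := by
    rw [intervalIntegrable_iff_integrableOn_Ioo_of_le zero_le_one]
    have := (h.data_vel.sub hw2).integrable_sq.const_mul (1 / 4)
    refine this.congr (Filter.Eventually.of_forall fun x => ?_)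
    simp only [Pi.sub_apply]
    ring
  have hv' := ((IntervalIntegrable.iff_comp_neg (by simp)).1 hv).symm
  rw [neg_zero] at hv'
  have hvel := h.init_vel
  rw [ae_restrict_iff' measurableSet_Ioo] at hvel
  -- At time zero `u_x = f(x) - g(-x)` is `w` and `u_t = f(x) + g(-x)` is `u₁`; subtracting isolates
  -- `g(-x)`. Local integrability on `(-1, ∞)` says nothing near `-1`, so the data are needed there.
  have key : ∀ᵐ x : ℝ, x ∈ Ioo (0 : ℝ) 1 → g (-x) = (u₁ x - w x) / 2 := by
    filter_upwards [hvel, hwi.ae_hasDerivAt_integral, hF, ae_comp_const_sub hG 0]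
      with x hx1 hx2 hx3 hx4 hx
    have hG' := hx4 (by linarith [hx.2])
    have hF' : HasDerivAt F (f x) (0 + x) := by rw [zero_add]; exact hx3 hx.1
    have hl : x < endpoint k 0 := by simpa [endpoint] using hx.2
    have d1 := hu.hasDerivAt_x hx.1 hl le_rfl hF' hG' (by linarith [hx.2])
    have d2 := hu.hasDerivWithinAt_t_Ici_zero hx.1 hl le_rfl hF' hG' (by linarith [hx.2])
    have hxI : x ∈ uIcc (0 : ℝ) 1 := by
      rw [uIcc_of_le zero_le_one]; exact Ioo_subset_Icc_self hx
    have d3 : HasDerivAt (fun y => u (y, 0)) (w x) x := by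
      have := (hx2 hxI 0 (by simp)).const_add (u₀ 0)
      refine this.congr_of_eventuallyEq ?_
      filter_upwards [Ioo_mem_nhds hx.1 hx.2] with y hy
      rw [h.init_pos y (Ioo_subset_Icc_self hy), hw y (Ioo_subset_Icc_self hy)]
    have e1 := d1.unique d3
    have e2 := UniqueDiffWithinAt.eq_deriv (Ici (0 : ℝ)) (uniqueDiffWithinAt_Ici 0) d2
      (hx1 hx)
    rw [zero_sub] at e1 e2
    linarith
  refine hv'.congr_ae ?_
  rw [Filter.EventuallyEq, ae_restrict_iff' measurableSet_uIoc]
  have hne : ∀ᵐ s : ℝ, s ≠ 0 := by simp [ae_iff, measure_singleton]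
  filter_upwards [ae_comp_const_sub key 0, hne] with s hs hs0 hsm
  rw [uIoc_of_le (by norm_num)] at hsm
  have hs' := hs ⟨by simpa using lt_of_le_of_ne hsm.2 hs0, by linarith [hsm.1]⟩
  simp only [zero_sub, neg_neg] at hs'
  simp only [hs']

/-- The energy of a weak solution in terms of one profile `g` on `(-1, ∞)`, which satisfies a
functional equation given by the boundary condition at the moving end. -/
theorem IsWeakSolution.exists_profile {k a : ℝ} (hk0 : 0 < k) (hk1 : k < 1) {u₀ u₁ : ℝ → ℝ}
    {u : ℝ × ℝ → ℝ} (h : IsWeakSolution k a u₀ u₁ u) :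
    ∃ g : ℝ → ℝ,
      (∀ M, -1 ≤ M → IntervalIntegrable (fun s => g s ^ 2) volume (-1) M) ∧
      (∀ t, 0 ≤ t → EnergyWellDefined k u t ∧
        energy k u t = ∫ s in ((1 - k) * t - 1)..((1 + k) * t + 1), g s ^ 2) ∧
      ∀ᵐ t, 0 < t → (1 + a) * g ((1 + k) * t + 1) = (1 - a) * g ((1 - k) * t - 1) := by
  obtain ⟨f, g, F, G, hF, hG, hgl, hu⟩ := h.dalembert hk0 hk1
  change IsDalembert k u F G at hu
  have hlpos : ∀ t, 0 ≤ t → 0 < endpoint k t := fun t ht => by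
    simp only [endpoint]; nlinarith
  -- At the fixed end `u_x(0, s) = f(s) - g(s)`, which the Neumann condition sets to zero.
  have hfg : ∀ᵐ s, 0 < s → f s = g s := by
    have hbc := h.left_bc
    rw [ae_restrict_iff' measurableSet_Ioi] at hbc
    filter_upwards [hF, hG, hbc] with s h1 h2 h3 hs
    have d := hu.hasDerivWithinAt_x le_rfl (hlpos s hs.le).le hs.le
      (by simpa using h1 hs) (by simpa using h2 (by linarith)) (by linarith) (by linarith)
    have d' := (h3 hs).mono (s := Icc 0 (endpoint k s)) Icc_subset_Ici_self
    have hud : UniqueDiffWithinAt ℝ (Icc 0 (endpoint k s)) 0 :=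
      uniqueDiffOn_Icc (hlpos s hs.le) 0 (left_mem_Icc.2 (hlpos s hs.le).le)
    have := hud.eq_deriv (Icc 0 (endpoint k s)) d d'
    linarith
  have hint : ∀ M, -1 ≤ M → IntervalIntegrable (fun s => g s ^ 2) volume (-1) M := by
    intro M hM
    rcases hM.eq_or_lt with rfl | hM
    · exact IntervalIntegrable.refl
    · exact (h.intervalIntegrable_sq hF hG hu).trans
        (intervalIntegrable_of_locallyIntegrableOn hgl (by simp) hM)
  have hint' : ∀ {M N : ℝ}, -1 ≤ M → -1 ≤ N →
      IntervalIntegrable (fun s => g s ^ 2) volume M N :=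
    fun hM hN => (hint _ hM).symm.trans (hint _ hN)
  refine ⟨g, hint, fun t ht => ?_, ?_⟩
  · have hl := hlpos t ht
    have hkt : k * t ≤ t := by nlinarith
    have hder : ∀ᵐ x : ℝ, x ∈ Ioo 0 (endpoint k t) →
        HasDerivWithinAt (fun s => u (x, s)) (g (t + x) + g (t - x)) (Ici 0) t ∧
        HasDerivAt (fun y => u (y, t)) (g (t + x) - g (t - x)) x := by
      filter_upwards [ae_comp_const_add hF t, ae_comp_const_sub hG t, ae_comp_const_add hfg t]
        with x h1 h2 h3 hx
      have hx1 : 0 < t + x := by linarith [hx.1]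
      have hx2 : -1 < t - x := by
        have := hx.2
        simp only [endpoint] at this
        linarith
      have h1' := h1 hx1
      rw [h3 hx1] at h1'
      exact ⟨hu.hasDerivWithinAt_t_Ici_zero hx.1 hx.2 ht h1' (h2 hx2) hx2,
        hu.hasDerivAt_x hx.1 hx.2 ht h1' (h2 hx2) hx2⟩
    have hdens : ∀ᵐ x : ℝ, x ∈ Ioo 0 (endpoint k t) →
        2 * (g (t + x) ^ 2 + g (t - x) ^ 2) = energyDensity u t x := by
      filter_upwards [hder] with x hx hxm
      obtain ⟨h1, h2⟩ := hx hxm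
      rw [energyDensity, h2.deriv, h1.derivWithin (uniqueDiffOn_Ici 0 t ht)]
      ring
    have hdens' : ∀ᵐ x : ℝ, x ∈ uIoc 0 (endpoint k t) →
        2 * (g (t + x) ^ 2 + g (t - x) ^ 2) = energyDensity u t x := by
      have hne : ∀ᵐ x : ℝ, x ≠ endpoint k t := by simp [ae_iff, measure_singleton]
      filter_upwards [hdens, hne] with x hx hne hxm
      rw [uIoc_of_le hl.le] at hxm
      exact hx ⟨hxm.1, lt_of_le_of_ne hxm.2 hne⟩
    have i1 : IntervalIntegrable (fun x => g (t + x) ^ 2) volume 0 (endpoint k t) := by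
      have := (hint' (M := t) (N := t + endpoint k t) (by linarith) (by linarith)).comp_add_left t
      simpa using this
    have i2 : IntervalIntegrable (fun x => g (t - x) ^ 2) volume 0 (endpoint k t) := by
      have := (hint' (M := t) (N := t - endpoint k t) (by linarith)
        (by simp only [endpoint]; linarith)).comp_sub_left t
      simpa using this
    refine ⟨⟨?_, ?_⟩, ?_⟩
    · rw [ae_restrict_iff' measurableSet_Ioo]
      filter_upwards [hder] with x hx hxm
      exact ⟨(hx hxm).1.differentiableWithinAt, (hx hxm).2.differentiableAt⟩
    · refine ((i1.add i2).const_mul 2).congr_ae ?_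
      rw [Filter.EventuallyEq, ae_restrict_iff' measurableSet_uIoc]
      exact hdens'
    -- After substitution the two terms become integrals of `g ^ 2` over the adjacent intervals to
    -- the right and to the left of `t`, which merge into one window.
    · rw [energy, ← intervalIntegral.integral_congr_ae hdens',
        intervalIntegral.integral_const_mul, intervalIntegral.integral_add i1 i2,
        intervalIntegral.integral_comp_add_left (fun s => g s ^ 2) t,
        intervalIntegral.integral_comp_sub_left (fun s => g s ^ 2) t]
      have e1 : t - endpoint k t = (1 - k) * t - 1 := by simp only [endpoint]; ring
      have e2 : t + endpoint k t = (1 + k) * t + 1 := by simp only [endpoint]; ring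
      have hl1 : -1 ≤ (1 - k) * t - 1 := by nlinarith
      have hl2 : -1 ≤ (1 + k) * t + 1 := by nlinarith
      rw [e1, e2, add_zero, sub_zero, ← intervalIntegral.integral_add_adjacent_intervals
        (hint' hl1 (by linarith : -1 ≤ t)) (hint' (by linarith : -1 ≤ t) hl2)]
      ring
  · have hbc := h.right_bc
    rw [ae_restrict_iff' measurableSet_Ioi] at hbc
    -- Both characteristic coordinates of the moving end are affine in `t` with slopes `1 + k` and
    -- `1 - k`, nonzero, so exceptional null sets of `s` pull back to null sets of times.
    filter_upwards [hbc, ae_comp_affine hF (by linarith : 1 + k ≠ 0) 1,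
      ae_comp_affine hG (by linarith : 1 - k ≠ 0) (-1),
      ae_comp_affine hfg (by linarith : 1 + k ≠ 0) 1] with t h1 h2 h3 h4 ht
    obtain ⟨ux, ut, dx, dt, hbd⟩ := h1 ht
    have hl := hlpos t ht.le
    have p1 : 0 < (1 + k) * t + 1 := by positivity
    have p2 : -1 < (1 - k) * t + -1 := by nlinarith
    have e1 : (1 + k) * t + 1 = t + endpoint k t := by simp only [endpoint]; ring
    have e2 : (1 - k) * t + -1 = t - endpoint k t := by simp only [endpoint]; ring
    have e3 : (1 - k) * t - 1 = t - endpoint k t := by simp only [endpoint]; ring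
    rw [e1] at h2 h4 p1
    rw [e2] at h3 p2
    rw [e1, e3]
    have dx' := hu.hasDerivWithinAt_x hl.le le_rfl ht.le (h2 p1) (h3 p2) p1 p2
    have dt' := hu.hasDerivWithinAt_t hk0 hl.le le_rfl ht.le (h2 p1) (h3 p2) p1 p2
    have hud : UniqueDiffWithinAt ℝ (Icc 0 (endpoint k t)) (endpoint k t) :=
      uniqueDiffOn_Icc hl _ (right_mem_Icc.2 hl.le)
    have q1 := hud.eq_deriv (Icc 0 (endpoint k t)) dx'
      (dx.mono (s := Icc 0 (endpoint k t)) Icc_subset_Iic_self)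
    have q2 := UniqueDiffWithinAt.eq_deriv _ (uniqueDiffWithinAt_Ici t) dt' dt
    rw [← q1, ← q2, h4 p1] at hbd
    linarith

/-! ### Weighted energies of a profile -/

/-- A square integrable profile on `(-1, ∞)` satisfying the functional equation of the moving
end. -/
structure IsProfile (k a : ℝ) (g : ℝ → ℝ) : Prop where
  integrable : ∀ M, -1 ≤ M → IntervalIntegrable (fun s => g s ^ 2) volume (-1) M
  bc : ∀ᵐ t, 0 < t → (1 + a) * g ((1 + k) * t + 1) = (1 - a) * g ((1 - k) * t - 1)

/-- The energy of a profile with a power weight. -/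
def weightedEnergy (k β : ℝ) (g : ℝ → ℝ) (t : ℝ) : ℝ :=
  ∫ s in ((1 - k) * t - 1)..((1 + k) * t + 1), (1 + k * s) ^ β * g s ^ 2

/-- The factor by which the weighted energy density is multiplied by a reflection at the moving
end. -/
def reflectionFactor (k a β : ℝ) : ℝ :=
  ((1 - a) / (1 + a)) ^ 2 * ((1 + k) / (1 - k)) ^ (1 + β)

lemma min_rpow_le_rpow {A B x : ℝ} (r : ℝ) (hA : 0 < A) (h1 : A ≤ x) (h2 : x ≤ B) :
    min (A ^ r) (B ^ r) ≤ x ^ r := by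
  rcases le_total 0 r with hr | hr
  · exact (min_le_left _ _).trans (Real.rpow_le_rpow hA.le h1 hr)
  · exact (min_le_right _ _).trans
      (Real.rpow_le_rpow_of_nonpos (hA.trans_le h1) h2 hr)

lemma rpow_le_max_rpow {A B x : ℝ} (r : ℝ) (hA : 0 < A) (h1 : A ≤ x) (h2 : x ≤ B) :
    x ^ r ≤ max (A ^ r) (B ^ r) := by
  rcases le_total 0 r with hr | hr
  · exact (Real.rpow_le_rpow (hA.le.trans h1) h2 hr).trans (le_max_right _ _)
  · exact (Real.rpow_le_rpow_of_nonpos hA h1 hr).trans (le_max_left _ _)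

namespace IsProfile

variable {k a : ℝ} {g : ℝ → ℝ}

lemma intervalIntegrable (h : IsProfile k a g) {M N : ℝ} (hM : -1 ≤ M) (hN : -1 ≤ N) :
    IntervalIntegrable (fun s => g s ^ 2) volume M N :=
  (h.integrable M hM).symm.trans (h.integrable N hN)

lemma intervalIntegrable_weight (h : IsProfile k a g) (hk0 : 0 < k) (hk1 : k < 1) (β : ℝ)
    {M N : ℝ} (hM : -1 ≤ M) (hN : -1 ≤ N) :
    IntervalIntegrable (fun s => (1 + k * s) ^ β * g s ^ 2) volume M N := by
  refine (h.intervalIntegrable hM hN).continuousOn_mul ?_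
  refine ContinuousOn.rpow_const (by fun_prop) fun s hs => Or.inl ?_
  have : -1 ≤ s := (le_min hM hN).trans hs.1
  nlinarith

/-- Between the two times the window loses a stretch on the left and gains one on the right. The
functional equation maps one to the other: `g` is multiplied by `(1 - a) / (1 + a)` and `1 + k y` by
`ρ = (1 + k) / (1 - k)`. The weight contributes `ρ ^ β` and the change of variables one more `ρ`, so
the gain is `reflectionFactor` times the loss. -/
lemma weightedEnergy_sub (h : IsProfile k a g) (hk0 : 0 < k) (hk1 : k < 1) (ha : a ≠ -1)
    (β : ℝ) {s t : ℝ} (hs : 0 ≤ s) (hst : s ≤ t) :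
    weightedEnergy k β g t - weightedEnergy k β g s = (reflectionFactor k a β - 1) *
      ∫ y in ((1 - k) * s - 1)..((1 - k) * t - 1), (1 + k * y) ^ β * g y ^ 2 := by
  have ha' : 1 + a ≠ 0 := fun h => ha (by linarith)
  have hk1' : 0 < 1 - k := by linarith
  have hk2 : 0 < 1 + k := by linarith
  have n1 : ∀ τ, 0 ≤ τ → -1 ≤ (1 - k) * τ - 1 := fun τ hτ => by nlinarith
  have n2 : ∀ τ, 0 ≤ τ → -1 ≤ (1 + k) * τ + 1 := fun τ hτ => by nlinarith
  have ht : 0 ≤ t := hs.trans hst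
  have hi := fun {M N : ℝ} (hM : -1 ≤ M) (hN : -1 ≤ N) =>
    h.intervalIntegrable_weight hk0 hk1 β hM hN
  have e1 := intervalIntegral.integral_interval_sub_interval_comm
    (hi (n1 t ht) (n2 t ht)) (hi (n1 s hs) (n2 s hs)) (hi (n1 t ht) (n1 s hs))
  have c1 := intervalIntegral.smul_integral_comp_mul_add
    (fun y => (1 + k * y) ^ β * g y ^ 2) (1 + k) 1 (a := s) (b := t)
  have c2 := intervalIntegral.smul_integral_comp_mul_add
    (fun y => (1 + k * y) ^ β * g y ^ 2) (1 - k) (-1) (a := s) (b := t)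
  simp only [smul_eq_mul, ← sub_eq_add_neg] at c1 c2
  have key : ∫ τ in s..t, (1 + k * ((1 + k) * τ + 1)) ^ β * g ((1 + k) * τ + 1) ^ 2 =
      (((1 - a) / (1 + a)) ^ 2 * ((1 + k) / (1 - k)) ^ β) *
      ∫ τ in s..t, (1 + k * ((1 - k) * τ - 1)) ^ β * g ((1 - k) * τ - 1) ^ 2 := by
    rw [← intervalIntegral.integral_const_mul]
    apply intervalIntegral.integral_congr_ae
    filter_upwards [h.bc] with τ hτ hm
    rw [uIoc_of_le hst] at hm
    have hτ0 : 0 < τ := hs.trans_lt hm.1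
    have hg : g ((1 + k) * τ + 1) = (1 - a) / (1 + a) * g ((1 - k) * τ - 1) := by
      rw [div_mul_eq_mul_div, eq_div_iff ha', ← hτ hτ0]; ring
    -- The two sides are `(1 + k) (1 + k τ)` and `ρ (1 - k) (1 + k τ)`: the weight is adapted to
    -- this scaling.
    have hw : 1 + k * ((1 + k) * τ + 1) =
        (1 + k) / (1 - k) * (1 + k * ((1 - k) * τ - 1)) := by
      field_simp
      ring
    have hp : 0 ≤ 1 + k * ((1 - k) * τ - 1) := by
      have : 0 ≤ (1 - k) * (1 + k * τ) := by positivity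
      linarith
    rw [hg, hw, Real.mul_rpow (by positivity) hp]
    ring
  have hρ : ((1 + k) / (1 - k)) ^ (1 + β) = (1 + k) / (1 - k) * ((1 + k) / (1 - k)) ^ β := by
    rw [Real.rpow_add (by positivity), Real.rpow_one]
  simp only [weightedEnergy]
  rw [e1, intervalIntegral.integral_symm ((1 - k) * s - 1) ((1 - k) * t - 1),
    intervalIntegral.integral_symm ((1 + k) * s + 1) ((1 + k) * t + 1), ← c1, key, ← c2,
    reflectionFactor, hρ]
  field_simp
  ring

lemma weightedEnergy_zero_eq (g : ℝ → ℝ) (t : ℝ) : weightedEnergy k 0 g t =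
    ∫ s in ((1 - k) * t - 1)..((1 + k) * t + 1), g s ^ 2 := by
  simp [weightedEnergy]

/-- On the window at time `t`, `1 + k s` runs from `(1 - k) (1 + k t)` to `(1 + k) (1 + k t)`, so
bounds for the power there compare weighted and unweighted energies. -/
lemma weightedEnergy_bounds (h : IsProfile k a g) (hk0 : 0 < k) (hk1 : k < 1) (β : ℝ) {t : ℝ}
    (ht : 0 ≤ t) {A B : ℝ}
    (hAB : ∀ x, (1 - k) * (1 + k * t) ≤ x → x ≤ (1 + k) * (1 + k * t) → A ≤ x ^ β ∧ x ^ β ≤ B) :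
    A * weightedEnergy k 0 g t ≤ weightedEnergy k β g t ∧
      weightedEnergy k β g t ≤ B * weightedEnergy k 0 g t := by
  have n1 : -1 ≤ (1 - k) * t - 1 := by nlinarith
  have n2 : -1 ≤ (1 + k) * t + 1 := by nlinarith
  have hle : (1 - k) * t - 1 ≤ (1 + k) * t + 1 := by nlinarith
  have hi := h.intervalIntegrable n1 n2
  have hiw := h.intervalIntegrable_weight hk0 hk1 β n1 n2
  have hx : ∀ s ∈ Icc ((1 - k) * t - 1) ((1 + k) * t + 1),
      A ≤ (1 + k * s) ^ β ∧ (1 + k * s) ^ β ≤ B := by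
    rintro s ⟨h1, h2⟩
    apply hAB <;> nlinarith
  rw [weightedEnergy_zero_eq, weightedEnergy, ← intervalIntegral.integral_const_mul,
    ← intervalIntegral.integral_const_mul]
  constructor
  · exact intervalIntegral.integral_mono_on hle (hi.const_mul A) hiw fun s hs =>
      mul_le_mul_of_nonneg_right (hx s hs).1 (sq_nonneg _)
  · exact intervalIntegral.integral_mono_on hle hiw (hi.const_mul B) fun s hs =>
      mul_le_mul_of_nonneg_right (hx s hs).2 (sq_nonneg _)

lemma integral_weight_nonneg (hk0 : 0 < k) (hk1 : k < 1) (β : ℝ) (g : ℝ → ℝ) {M N : ℝ}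
    (hM : -1 ≤ M) (hMN : M ≤ N) : 0 ≤ ∫ y in M..N, (1 + k * y) ^ β * g y ^ 2 := by
  refine intervalIntegral.integral_nonneg hMN fun s hs => ?_
  have h1 : -1 ≤ s := hM.trans hs.1
  have : 0 ≤ 1 + k * s := by nlinarith
  positivity

lemma weightedEnergy_mono (h : IsProfile k a g) (hk0 : 0 < k) (hk1 : k < 1) (ha : a ≠ -1)
    (β : ℝ) (hr : 1 ≤ reflectionFactor k a β) {s t : ℝ} (hs : 0 ≤ s) (hst : s ≤ t) :
    weightedEnergy k β g s ≤ weightedEnergy k β g t := by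
  rw [← sub_nonneg, h.weightedEnergy_sub hk0 hk1 ha β hs hst]
  exact mul_nonneg (by linarith)
    (integral_weight_nonneg hk0 hk1 β g (by nlinarith) (by nlinarith))

lemma weightedEnergy_anti (h : IsProfile k a g) (hk0 : 0 < k) (hk1 : k < 1) (ha : a ≠ -1)
    (β : ℝ) (hr : reflectionFactor k a β ≤ 1) {s t : ℝ} (hs : 0 ≤ s) (hst : s ≤ t) :
    weightedEnergy k β g t ≤ weightedEnergy k β g s := by
  rw [← sub_nonpos, h.weightedEnergy_sub hk0 hk1 ha β hs hst]
  exact mul_nonpos_of_nonpos_of_nonneg (by linarith)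
    (integral_weight_nonneg hk0 hk1 β g (by nlinarith) (by nlinarith))

/-- After the time needed for a complete reflection the energy is multiplied by the reflection
factor. -/
lemma exists_later_energy (h : IsProfile k a g) (hk0 : 0 < k) (hk1 : k < 1) (ha : a ≠ -1)
    {s : ℝ} (hs : 0 ≤ s) : ∃ t, s < t ∧
      weightedEnergy k 0 g t = reflectionFactor k a 0 * weightedEnergy k 0 g s := by
  have hk1' : 0 < 1 - k := by linarith
  -- This is the time at which the left end of the window reaches the right end of the window at
  -- time `s`, so that exactly the old window has been lost.
  have hlt : s < ((1 + k) * s + 2) / (1 - k) := by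
    rw [lt_div_iff₀ hk1']
    nlinarith
  refine ⟨_, hlt, ?_⟩
  have := h.weightedEnergy_sub hk0 hk1 ha 0 hs hlt.le
  have e : (1 - k) * (((1 + k) * s + 2) / (1 - k)) - 1 = (1 + k) * s + 1 := by
    field_simp; ring
  rw [e] at this
  change _ = _ * weightedEnergy k 0 g s at this
  linarith

/-- For `a = -1` the functional equation forces the profile to vanish. -/
lemma energy_eq_zero (h : IsProfile k (-1) g) (hk0 : 0 < k) (hk1 : k < 1) {t : ℝ}
    (ht : 0 ≤ t) : weightedEnergy k 0 g t = 0 := by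
  have hk1' : 1 - k ≠ 0 := by linarith
  -- For `a = -1` the equation is `0 = 2 g((1 - k) t - 1)`, and the argument sweeps all of `(-1,
  -- ∞)`.
  have hz : ∀ᵐ s, -1 < s → g s = 0 := by
    filter_upwards [ae_comp_affine h.bc (inv_ne_zero hk1') ((1 - k)⁻¹)] with s hs h1
    have hpos : 0 < (1 - k)⁻¹ * s + (1 - k)⁻¹ := by
      have : 0 < (1 - k)⁻¹ := inv_pos.2 (by linarith)
      nlinarith
    have e : (1 - k) * ((1 - k)⁻¹ * s + (1 - k)⁻¹) - 1 = s := by field_simp; ring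
    have := hs hpos
    rw [e] at this
    linarith
  rw [weightedEnergy_zero_eq, intervalIntegral.integral_congr_ae (g := fun _ => 0)]
  · simp
  · filter_upwards [hz] with s hs hsm
    rw [uIoc_of_le (by nlinarith)] at hsm
    rw [hs (by nlinarith [hsm.1])]
    simp

/-- When the reflection factor of a weight equals one, the energy is comparable with a power. -/
lemma energy_comparable (h : IsProfile k a g) (hk0 : 0 < k) (hk1 : k < 1) (ha : a ≠ -1)
    {β : ℝ} (hr : reflectionFactor k a β = 1) :
    ∃ c₁ c₂ : ℝ, 0 < c₁ ∧ 0 < c₂ ∧ ∀ t, 0 ≤ t →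
      c₁ * (1 + t) ^ (-β) * weightedEnergy k 0 g 0 ≤ weightedEnergy k 0 g t ∧
      weightedEnergy k 0 g t ≤ c₂ * (1 + t) ^ (-β) * weightedEnergy k 0 g 0 := by
  have hk1' : 0 < 1 - k := by linarith
  have hk2 : 0 < 1 + k := by linarith
  -- `m` and `M` bound the weight relative to `(1 + k t) ^ β`; `n` and `N` bound `((1 + k t) / (1 +
  -- t)) ^ β`, whose base lies in `[k, 1]`. Minima and maxima are taken because `β` may have either
  -- sign.
  set m := min ((1 - k) ^ β) ((1 + k) ^ β)
  set M := max ((1 - k) ^ β) ((1 + k) ^ β)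
  set n := min (k ^ β) (1 ^ β)
  set N := max (k ^ β) ((1 : ℝ) ^ β)
  have hm : 0 < m := lt_min (by positivity) (by positivity)
  have hn : 0 < n := lt_min (by positivity) (by positivity)
  have hM : 0 < M := lt_max_of_lt_left (by positivity)
  have hN : 0 < N := lt_max_of_lt_left (by positivity)
  have hb : ∀ t, 0 ≤ t → m * (1 + k * t) ^ β * weightedEnergy k 0 g t ≤ weightedEnergy k β g t ∧
      weightedEnergy k β g t ≤ M * (1 + k * t) ^ β * weightedEnergy k 0 g t := by
    intro t ht
    refine h.weightedEnergy_bounds hk0 hk1 β ht fun x h1 h2 => ?_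
    have hp : 0 < 1 + k * t := by positivity
    have h1' : 1 - k ≤ x / (1 + k * t) := by rwa [le_div_iff₀ hp]
    have h2' : x / (1 + k * t) ≤ 1 + k := by rwa [div_le_iff₀ hp]
    have hx : x ^ β = (x / (1 + k * t)) ^ β * (1 + k * t) ^ β := by
      rw [← Real.mul_rpow (by linarith) hp.le, div_mul_cancel₀ _ hp.ne']
    rw [hx]
    constructor
    · exact mul_le_mul_of_nonneg_right (min_rpow_le_rpow β hk1' h1' h2') (by positivity)
    · exact mul_le_mul_of_nonneg_right (rpow_le_max_rpow β hk1' h1' h2') (by positivity)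
  have hE : ∀ t, 0 ≤ t → 0 ≤ weightedEnergy k 0 g t := fun t ht =>
    integral_weight_nonneg hk0 hk1 0 g (by nlinarith) (by nlinarith)
  refine ⟨m / (M * N), M / (m * n), by positivity, by positivity, fun t ht => ?_⟩
  have hW : weightedEnergy k β g t = weightedEnergy k β g 0 :=
    le_antisymm (h.weightedEnergy_anti hk0 hk1 ha β hr.le le_rfl ht)
      (h.weightedEnergy_mono hk0 hk1 ha β hr.ge le_rfl ht)
  have ht1 : 0 < 1 + t := by positivity
  have hp : 0 < 1 + k * t := by positivity
  have q1 : k ≤ (1 + k * t) / (1 + t) := by rw [le_div_iff₀ ht1]; nlinarith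
  have q2 : (1 + k * t) / (1 + t) ≤ 1 := by rw [div_le_one ht1]; nlinarith
  have hx : (1 + k * t) ^ β = ((1 + k * t) / (1 + t)) ^ β * (1 + t) ^ β := by
    rw [← Real.mul_rpow (by positivity) ht1.le, div_mul_cancel₀ _ ht1.ne']
  have r1 := min_rpow_le_rpow β hk0 q1 q2
  have r2 := rpow_le_max_rpow β hk0 q1 q2
  have P : 0 < (1 + t) ^ β := by positivity
  obtain ⟨b1, b2⟩ := hb t ht
  obtain ⟨b3, b4⟩ := hb 0 le_rfl
  simp only [mul_zero, add_zero, Real.one_rpow, mul_one] at b3 b4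
  rw [hW, hx] at b1 b2
  rw [Real.rpow_neg ht1.le]
  have E0 := hE 0 le_rfl
  have Et := hE t ht
  constructor
  · have : m * weightedEnergy k 0 g 0 ≤ M * N * (1 + t) ^ β * weightedEnergy k 0 g t := by
      refine b3.trans (b2.trans ?_)
      rw [← mul_assoc, mul_assoc M N]
      have : M * ((1 + k * t) / (1 + t)) ^ β * (1 + t) ^ β ≤ M * (N * (1 + t) ^ β) := by
        rw [mul_assoc]
        gcongr
      exact mul_le_mul_of_nonneg_right this Et
    calc m / (M * N) * ((1 + t) ^ β)⁻¹ * weightedEnergy k 0 g 0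
        = (m * weightedEnergy k 0 g 0) / (M * N * (1 + t) ^ β) := by field_simp
      _ ≤ weightedEnergy k 0 g t := by
        rw [div_le_iff₀ (by positivity)]
        linarith
  · have : m * n * (1 + t) ^ β * weightedEnergy k 0 g t ≤ M * weightedEnergy k 0 g 0 := by
      refine le_trans ?_ (b1.trans b4)
      rw [← mul_assoc, mul_assoc m n]
      have : m * (n * (1 + t) ^ β) ≤ m * ((1 + k * t) / (1 + t)) ^ β * (1 + t) ^ β := by
        rw [mul_assoc]
        gcongr
      exact mul_le_mul_of_nonneg_right this Et
    calc weightedEnergy k 0 g t ≤ (M * weightedEnergy k 0 g 0) / (m * n * (1 + t) ^ β) := by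
          rw [le_div_iff₀ (by positivity)]
          linarith
      _ = M / (m * n) * ((1 + t) ^ β)⁻¹ * weightedEnergy k 0 g 0 := by field_simp

/-- First-order decay from above. -/
lemma energy_le_first_order (h : IsProfile k a g) (hk0 : 0 < k) (hk1 : k < 1) (ha : a ≠ -1)
    (hr : reflectionFactor k a 1 ≤ 1) {t : ℝ} (ht : 0 ≤ t) :
    weightedEnergy k 0 g t ≤
      (1 + k) / ((1 - k) * (1 + k * t)) * weightedEnergy k 0 g 0 := by
  -- With `β = 1` the weight is at least `(1 - k) (1 + k t)` at time `t` and at most `1 + k` at time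
  -- zero; monotonicity of the weighted energy links the two.
  have b1 := (h.weightedEnergy_bounds hk0 hk1 1 ht (A := (1 - k) * (1 + k * t))
    (B := (1 + k) * (1 + k * t)) fun x h1 h2 => by simpa using ⟨h1, h2⟩).1
  have b2 := (h.weightedEnergy_bounds hk0 hk1 1 le_rfl (A := 1 - k)
    (B := 1 + k) fun x h1 h2 => by simpa using And.intro h1 h2).2
  have b3 := h.weightedEnergy_anti hk0 hk1 ha 1 hr le_rfl ht
  have hk1' : 0 < 1 - k := by linarith
  rw [div_mul_eq_mul_div, le_div_iff₀ (by positivity)]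
  linarith

/-- First-order decay from below. -/
lemma first_order_le_energy (h : IsProfile k a g) (hk0 : 0 < k) (hk1 : k < 1) (ha : a ≠ -1)
    (hr : 1 ≤ reflectionFactor k a 1) {t : ℝ} (ht : 0 ≤ t) :
    (1 - k) / ((1 + k) * (1 + k * t)) * weightedEnergy k 0 g 0 ≤ weightedEnergy k 0 g t := by
  have b1 := (h.weightedEnergy_bounds hk0 hk1 1 ht (A := (1 - k) * (1 + k * t))
    (B := (1 + k) * (1 + k * t)) fun x h1 h2 => by simpa using ⟨h1, h2⟩).2
  have b2 := (h.weightedEnergy_bounds hk0 hk1 1 le_rfl (A := 1 - k)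
    (B := 1 + k) fun x h1 h2 => by simpa using And.intro h1 h2).1
  have b3 := h.weightedEnergy_mono hk0 hk1 ha 1 hr le_rfl ht
  rw [div_mul_eq_mul_div, div_le_iff₀ (by positivity)]
  linarith

end IsProfile

lemma IsWeakSolution.exists_isProfile {k a : ℝ} (hk0 : 0 < k) (hk1 : k < 1) {u₀ u₁ : ℝ → ℝ}
    {u : ℝ × ℝ → ℝ} (h : IsWeakSolution k a u₀ u₁ u) :
    ∃ g, IsProfile k a g ∧ ∀ t, 0 ≤ t →
      EnergyWellDefined k u t ∧ energy k u t = weightedEnergy k 0 g t := by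
  obtain ⟨g, h1, h2, h3⟩ := h.exists_profile hk0 hk1
  refine ⟨g, ⟨h1, h3⟩, fun t ht => ⟨(h2 t ht).1, ?_⟩⟩
  rw [(h2 t ht).2, IsProfile.weightedEnergy_zero_eq]

/-! ### From smooth profiles to weak solutions -/

lemma hasDerivAt_pdx {φ : ℝ × ℝ → ℝ} (hφ : Differentiable ℝ φ) (x t : ℝ) :
    HasDerivAt (fun y => φ (y, t)) (fderiv ℝ φ (x, t) (1, 0)) x := by
  have h1 : HasDerivAt (fun y : ℝ => (y, t)) ((1 : ℝ), (0 : ℝ)) x :=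
    (hasDerivAt_id x).prodMk (hasDerivAt_const x t)
  exact (hφ (x, t)).hasFDerivAt.comp_hasDerivAt x h1

lemma hasDerivAt_pdt {φ : ℝ × ℝ → ℝ} (hφ : Differentiable ℝ φ) (x t : ℝ) :
    HasDerivAt (fun s => φ (x, s)) (fderiv ℝ φ (x, t) (0, 1)) t := by
  have h1 : HasDerivAt (fun s : ℝ => (x, s)) ((0 : ℝ), (1 : ℝ)) t :=
    (hasDerivAt_const t x).prodMk (hasDerivAt_id t)
  exact (hφ (x, t)).hasFDerivAt.comp_hasDerivAt t h1

lemma isTestFunction_fderiv {Ω : Set (ℝ × ℝ)} {φ : ℝ × ℝ → ℝ} (hφ : IsTestFunction Ω φ)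
    (v : ℝ × ℝ) : IsTestFunction Ω (fun z => fderiv ℝ φ z v) ∧
      tsupport (fun z => fderiv ℝ φ z v) ⊆ tsupport φ := by
  obtain ⟨h1, h2, h3⟩ := hφ
  have hsub : tsupport (fun z => fderiv ℝ φ z v) ⊆ tsupport φ := tsupport_fderiv_apply_subset ℝ v
  refine ⟨⟨?_, h2.of_isClosed_subset (isClosed_tsupport _) hsub, hsub.trans h3⟩, hsub⟩
  exact (h1.fderiv_right (m := ∞) (by simp)).clm_apply contDiff_const

lemma pdx_eq_fderiv {φ : ℝ × ℝ → ℝ} (hφ : Differentiable ℝ φ) :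
    pdx φ = fun z => fderiv ℝ φ z (1, 0) :=
  funext fun z => (hasDerivAt_pdx hφ z.1 z.2).deriv

lemma pdt_eq_fderiv {φ : ℝ × ℝ → ℝ} (hφ : Differentiable ℝ φ) :
    pdt φ = fun z => fderiv ℝ φ z (0, 1) :=
  funext fun z => (hasDerivAt_pdt hφ z.1 z.2).deriv

lemma IsTestFunction.pdx {Ω : Set (ℝ × ℝ)} {φ : ℝ × ℝ → ℝ} (hφ : IsTestFunction Ω φ) :
    IsTestFunction Ω (pdx φ) := by
  rw [pdx_eq_fderiv (hφ.1.differentiable (by simp))]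
  exact (isTestFunction_fderiv hφ _).1

lemma IsTestFunction.pdt {Ω : Set (ℝ × ℝ)} {φ : ℝ × ℝ → ℝ} (hφ : IsTestFunction Ω φ) :
    IsTestFunction Ω (pdt φ) := by
  rw [pdt_eq_fderiv (hφ.1.differentiable (by simp))]
  exact (isTestFunction_fderiv hφ _).1

lemma setIntegral_mul_test {Ω : Set (ℝ × ℝ)} {ψ : ℝ × ℝ → ℝ} (v : ℝ × ℝ → ℝ)
    (hs : tsupport ψ ⊆ Ω) : ∫ z in Ω, v z * ψ z = ∫ z, v z * ψ z :=
  setIntegral_eq_integral_of_forall_compl_eq_zero fun z hz => by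
    rw [image_eq_zero_of_notMem_tsupport fun h => hz (hs h), mul_zero]

/-- Integration by parts in one variable, against a function whose support lies in a compact set
on which the other factor is continuously differentiable. -/
lemma integral_mul_deriv_of_compact {K : Set ℝ} (hK : IsCompact K) {v v' ψ ψ' : ℝ → ℝ}
    (hv : ∀ x ∈ K, HasDerivAt v (v' x) x) (hv' : ContinuousOn v' K)
    (hψ : ∀ x, HasDerivAt ψ (ψ' x) x) (hψ' : Continuous ψ') (hs : ∀ x, x ∉ K → ψ x = 0)
    (hs' : ∀ x, x ∉ K → ψ' x = 0) :
    ∫ x, v x * ψ' x = - ∫ x, v' x * ψ x := by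
  have hψc : Continuous ψ := continuous_iff_continuousAt.2 fun x => (hψ x).continuousAt
  have hvc : ContinuousOn v K := fun x hx => (hv x hx).continuousAt.continuousWithinAt
  have hsub : tsupport ψ ⊆ K := closure_minimal (fun x hx => by
    by_contra h; exact hx (hs x h)) hK.isClosed
  exact integral_mul_deriv_eq_deriv_mul_of_integrable (fun x hx => hv x (hsub hx))
    (fun x _ => hψ x)
    (integrable_mul_of_compact hK (hvc.integrableOn_compact hK) hψ' hs')
    (integrable_mul_of_compact hK (hv'.integrableOn_compact hK) hψc hs)
    (integrable_mul_of_compact hK (hvc.integrableOn_compact hK) hψc hs)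

/-- A classical derivative in the space variable is a weak derivative. -/
lemma weak_pdx_of_classical {Ω : Set (ℝ × ℝ)} {v p φ : ℝ × ℝ → ℝ} (hφ : IsTestFunction Ω φ)
    (hv : ContinuousOn v Ω) (hp : ContinuousOn p Ω)
    (hd : ∀ z ∈ Ω, HasDerivAt (fun x => v (x, z.2)) (p z) z.1) :
    ∫ z in Ω, v z * pdx φ z = - ∫ z in Ω, p z * φ z := by
  have hdiff := hφ.1.differentiable (by simp)
  obtain ⟨⟨h1, h2, h3⟩, hsub⟩ := isTestFunction_fderiv hφ (1, 0)
  rw [pdx_eq_fderiv hdiff, setIntegral_mul_test v h3, setIntegral_mul_test p hφ.2.2]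
  have hK : IsCompact (tsupport φ) := hφ.2.1
  have i1 := integrable_mul_of_compact hK ((hv.mono hφ.2.2).integrableOn_compact hK (μ := volume))
    h1.continuous (fun z hz => image_eq_zero_of_notMem_tsupport
      (f := fun z => fderiv ℝ φ z (1, 0)) fun h => hz (hsub h))
  have i2 := integrable_mul_of_compact hK ((hp.mono hφ.2.2).integrableOn_compact hK (μ := volume))
    hφ.1.continuous (fun z hz => image_eq_zero_of_notMem_tsupport hz)
  rw [Measure.volume_eq_prod] at i1 i2 ⊢
  rw [integral_prod_symm _ i1, integral_prod_symm _ i2, ← integral_neg]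
  congr 1
  ext t
  have hKt : IsCompact ((fun x : ℝ => (x, t)) ⁻¹' tsupport φ) :=
    (Topology.IsClosedEmbedding.of_continuous_injective_isClosedMap (f := fun x : ℝ => (x, t))
        (by fun_prop) (fun _ _ h => (Prod.ext_iff.1 h).1)
        (isClosedMap_prodMk_right t)).isCompact_preimage hK
  refine integral_mul_deriv_of_compact hKt (fun x hx => hd (x, t) (hφ.2.2 hx))
    ((hp.mono hφ.2.2).comp (by fun_prop) fun x hx => hx) (fun x => hasDerivAt_pdx hdiff x t)
    (h1.continuous.comp (by fun_prop : Continuous fun x : ℝ => (x, t)))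
    (fun x hx => image_eq_zero_of_notMem_tsupport hx)
    (fun x hx => image_eq_zero_of_notMem_tsupport (f := fun z => fderiv ℝ φ z (1, 0))
      fun h => hx (hsub h))

/-- A classical derivative in the time variable is a weak derivative. -/
lemma weak_pdt_of_classical {Ω : Set (ℝ × ℝ)} {v q φ : ℝ × ℝ → ℝ} (hφ : IsTestFunction Ω φ)
    (hv : ContinuousOn v Ω) (hq : ContinuousOn q Ω)
    (hd : ∀ z ∈ Ω, HasDerivAt (fun t => v (z.1, t)) (q z) z.2) :
    ∫ z in Ω, v z * pdt φ z = - ∫ z in Ω, q z * φ z := by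
  have hdiff := hφ.1.differentiable (by simp)
  obtain ⟨⟨h1, h2, h3⟩, hsub⟩ := isTestFunction_fderiv hφ (0, 1)
  rw [pdt_eq_fderiv hdiff, setIntegral_mul_test v h3, setIntegral_mul_test q hφ.2.2]
  have hK : IsCompact (tsupport φ) := hφ.2.1
  have i1 := integrable_mul_of_compact hK ((hv.mono hφ.2.2).integrableOn_compact hK (μ := volume))
    h1.continuous (fun z hz => image_eq_zero_of_notMem_tsupport
      (f := fun z => fderiv ℝ φ z (0, 1)) fun h => hz (hsub h))
  have i2 := integrable_mul_of_compact hK ((hq.mono hφ.2.2).integrableOn_compact hK (μ := volume))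
    hφ.1.continuous (fun z hz => image_eq_zero_of_notMem_tsupport hz)
  rw [Measure.volume_eq_prod] at i1 i2 ⊢
  rw [integral_prod _ i1, integral_prod _ i2, ← integral_neg]
  congr 1
  ext x
  have hKx : IsCompact ((fun t : ℝ => (x, t)) ⁻¹' tsupport φ) :=
    (Topology.IsClosedEmbedding.of_continuous_injective_isClosedMap (f := fun t : ℝ => (x, t))
        (by fun_prop) (fun _ _ h => (Prod.ext_iff.1 h).2)
        (isClosedMap_prodMk_left x)).isCompact_preimage hK
  refine integral_mul_deriv_of_compact hKx (fun t ht => hd (x, t) (hφ.2.2 ht))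
    ((hq.mono hφ.2.2).comp (by fun_prop) fun x hx => hx) (fun t => hasDerivAt_pdt hdiff x t)
    (h1.continuous.comp (by fun_prop : Continuous fun t : ℝ => (x, t)))
    (fun x hx => image_eq_zero_of_notMem_tsupport hx)
    (fun x hx => image_eq_zero_of_notMem_tsupport (f := fun z => fderiv ℝ φ z (0, 1))
      fun h => hx (hsub h))

lemma closure_domain_subset (k : ℝ) :
    closure (domain k) ⊆ {z : ℝ × ℝ | 0 ≤ z.1 ∧ z.1 ≤ endpoint k z.2 ∧ 0 ≤ z.2} := by
  refine closure_minimal (fun z hz => ⟨hz.1.le, hz.2.1.le, hz.2.2.le⟩) ?_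
  simp only [endpoint, ofPred_and]
  exact (isClosed_le continuous_const continuous_fst).inter
    ((isClosed_le continuous_fst (by fun_prop)).inter (isClosed_le continuous_const continuous_snd))

/-- Since `x ≤ 1 + k t`, one has `t - x ≥ (1 - k) t - 1 ≥ -1`. Hence a profile regular on `(r, ∞)`
with `r < -1` gives a function regular up to the whole boundary, corners included. -/
lemma characteristic_mem {k : ℝ} (hk0 : 0 < k) (hk1 : k < 1) {z : ℝ × ℝ}
    (hz : z ∈ closure (domain k)) : z.2 + z.1 ∈ Ici (-1 : ℝ) ∧ z.2 - z.1 ∈ Ici (-1 : ℝ) := by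
  obtain ⟨h1, h2, h3⟩ := closure_domain_subset k hz
  simp only [endpoint] at h2
  simp only [mem_Ici]
  constructor <;> nlinarith

lemma memLp_of_isCompact {X : Type*} [TopologicalSpace X] [T2Space X] [MeasurableSpace X]
    [OpensMeasurableSpace X] {μ : Measure X} [IsFiniteMeasureOnCompacts μ] {p : X → ℝ} {K : Set X}
    (hK : IsCompact K) (hp : ContinuousOn p K) : MemLp p 2 (μ.restrict K) := by
  have : IsFiniteMeasure (μ.restrict K) := ⟨by simpa using hK.measure_lt_top⟩
  obtain ⟨C, hC⟩ := hK.exists_bound_of_continuousOn hp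
  refine MemLp.of_bound (hp.integrableOn_compact hK).aestronglyMeasurable C ?_
  rw [ae_restrict_iff' hK.measurableSet]
  exact Filter.Eventually.of_forall hC

/-- A continuous function on the closed domain is square integrable on the truncated domains. -/
lemma memLp_of_continuousOn {k : ℝ} (hk0 : 0 < k) {p : ℝ × ℝ → ℝ}
    (hp : ContinuousOn p (closure (domain k))) (T : ℝ) :
    MemLp p 2 (volume.restrict (domainUpTo k T)) := by
  have hK : IsCompact (closure (domain k) ∩ (Icc 0 (endpoint k T) ×ˢ Icc 0 T)) :=
    (isCompact_Icc.prod isCompact_Icc).inter_left isClosed_closure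
  have hsub : domainUpTo k T ⊆ closure (domain k) ∩ (Icc 0 (endpoint k T) ×ˢ Icc 0 T) := by
    rintro z ⟨hz, hzT⟩
    refine ⟨subset_closure hz, ⟨hz.1.le, hz.2.1.le.trans ?_⟩, hz.2.2.le, hzT.le⟩
    simp only [endpoint]
    nlinarith
  have : MemLp p 2 (volume.restrict (closure (domain k) ∩ (Icc 0 (endpoint k T) ×ˢ Icc 0 T))) :=
    memLp_of_isCompact hK (hp.mono inter_subset_left)
  exact this.mono_measure (Measure.restrict_mono_set _ hsub)

/-- A continuously differentiable profile satisfying the functional equation of the moving end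
gives a weak solution. -/
theorem isWeakSolution_of_profile {k a r : ℝ} (hk0 : 0 < k) (hk1 : k < 1) (hr : r < -1)
    {Φ γ γ' : ℝ → ℝ} (hΦ : ∀ s, r < s → HasDerivAt Φ (γ s) s)
    (hγ : ∀ s, r < s → HasDerivAt γ (γ' s) s) (hγ' : ContinuousOn γ' (Ioi r))
    (hbc : ∀ t, 0 < t → (1 + a) * γ ((1 + k) * t + 1) = (1 - a) * γ ((1 - k) * t - 1)) :
    IsWeakSolution k a (fun x => Φ x + Φ (-x)) (fun x => γ x + γ (-x))
      (fun z => Φ (z.2 + z.1) + Φ (z.2 - z.1)) := by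
  set u : ℝ × ℝ → ℝ := fun z => Φ (z.2 + z.1) + Φ (z.2 - z.1) with hu
  have hsub : Ici (-1 : ℝ) ⊆ Ioi r := Ici_subset_Ioi.2 hr
  have hΦc : ContinuousOn Φ (Ioi r) := fun s hs => (hΦ s hs).continuousAt.continuousWithinAt
  have hγc : ContinuousOn γ (Ioi r) := fun s hs => (hγ s hs).continuousAt.continuousWithinAt
  have hchar : ∀ z ∈ closure (domain k), r < z.2 + z.1 ∧ r < z.2 - z.1 := fun z hz =>
    ⟨hsub (characteristic_mem hk0 hk1 hz).1, hsub (characteristic_mem hk0 hk1 hz).2⟩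
  have hcharD : ∀ z ∈ domain k, r < z.2 + z.1 ∧ r < z.2 - z.1 := fun z hz =>
    hchar z (subset_closure hz)
  have hplus : ∀ ψ : ℝ → ℝ, ContinuousOn ψ (Ioi r) →
      ContinuousOn (fun z : ℝ × ℝ => ψ (z.2 + z.1)) (closure (domain k)) := fun ψ hψ =>
    hψ.comp (f := fun z : ℝ × ℝ => z.2 + z.1) (by fun_prop) fun z hz => (hchar z hz).1
  have hminus : ∀ ψ : ℝ → ℝ, ContinuousOn ψ (Ioi r) →
      ContinuousOn (fun z : ℝ × ℝ => ψ (z.2 - z.1)) (closure (domain k)) := fun ψ hψ =>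
    hψ.comp (f := fun z : ℝ × ℝ => z.2 - z.1) (by fun_prop) fun z hz => (hchar z hz).2
  have huc : ContinuousOn u (closure (domain k)) := (hplus Φ hΦc).add (hminus Φ hΦc)
  have hpc : ContinuousOn (fun z : ℝ × ℝ => γ (z.2 + z.1) - γ (z.2 - z.1))
    (closure (domain k)) := (hplus γ hγc).sub (hminus γ hγc)
  have hqc : ContinuousOn (fun z : ℝ × ℝ => γ (z.2 + z.1) + γ (z.2 - z.1))
    (closure (domain k)) := (hplus γ hγc).add (hminus γ hγc)
  have hrc : ContinuousOn (fun z : ℝ × ℝ => γ' (z.2 + z.1) + γ' (z.2 - z.1))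
    (closure (domain k)) := (hplus γ' hγ').add (hminus γ' hγ')
  have hux : ∀ z ∈ domain k, HasDerivAt (fun x => u (x, z.2))
      (γ (z.2 + z.1) - γ (z.2 - z.1)) z.1 := fun z hz =>
    hasDerivAt_dalembert_x (hΦ _ (hcharD z hz).1) (hΦ _ (hcharD z hz).2)
  have hut : ∀ z ∈ domain k, HasDerivAt (fun t => u (z.1, t))
      (γ (z.2 + z.1) + γ (z.2 - z.1)) z.2 := fun z hz =>
    hasDerivAt_dalembert_t (hΦ _ (hcharD z hz).1) (hΦ _ (hcharD z hz).2)
  have hpx : ∀ z ∈ domain k, HasDerivAt (fun x => γ (z.2 + x) - γ (z.2 - x))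
      (γ' (z.2 + z.1) + γ' (z.2 - z.1)) z.1 := fun z hz => by
    have := ((hγ _ (hcharD z hz).1).comp_const_add z.2 z.1).sub
      ((hγ _ (hcharD z hz).2).comp_const_sub z.2 z.1)
    rwa [sub_neg_eq_add] at this
  have hqt : ∀ z ∈ domain k, HasDerivAt (fun t => γ (t + z.1) + γ (t - z.1))
      (γ' (z.2 + z.1) + γ' (z.2 - z.1)) z.2 := fun z hz =>
    hasDerivAt_dalembert_t (hγ _ (hcharD z hz).1) (hγ _ (hcharD z hz).2)
  have hdal : IsDalembert k u Φ Φ := fun x t _ _ _ _ _ => rfl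
  have hlpos : ∀ t, 0 < t → 0 < endpoint k t := fun t ht => by
    simp only [endpoint]; positivity
  have hunit : ∀ x ∈ Icc (0 : ℝ) 1, x ∈ Ioi r ∧ -x ∈ Ioi r := fun x hx =>
    ⟨by simp only [mem_Ioi]; linarith [hx.1], by simp only [mem_Ioi]; linarith [hx.2]⟩
  have hγ1 : ContinuousOn γ (Icc 0 1) := hγc.mono fun x hx => (hunit x hx).1
  have hγ2 : ContinuousOn (fun x => γ (-x)) (Icc 0 1) :=
    hγc.comp (by fun_prop) fun x hx => (hunit x hx).2
  have hmem : ∀ w : ℝ → ℝ, ContinuousOn w (Icc 0 1) →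
      MemLp w 2 (volume.restrict (Ioo (0 : ℝ) 1)) := fun w hw =>
    (memLp_of_isCompact isCompact_Icc hw).mono_measure
      (Measure.restrict_mono_set _ Ioo_subset_Icc_self)
  refine ⟨⟨fun x => γ x - γ (-x), hmem _ (hγ1.sub hγ2), ?_⟩, hmem _ (hγ1.add hγ2), ⟨huc,
    _, _, fun T _ => ⟨memLp_of_continuousOn hk0 hpc T, memLp_of_continuousOn hk0 hqc T⟩,
    fun φ hφ => ⟨weak_pdx_of_classical hφ (huc.mono subset_closure) (hpc.mono subset_closure) hux,
      weak_pdt_of_classical hφ (huc.mono subset_closure) (hqc.mono subset_closure) hut⟩⟩,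
    ?_, ?_, ?_, ?_, ?_⟩
  · intro x hx
    have hxu : uIcc 0 x ⊆ Icc 0 1 := by
      rw [uIcc_of_le hx.1]; exact Icc_subset_Icc_right hx.2
    rw [intervalIntegral.integral_eq_sub_of_hasDerivAt (f := fun x => Φ x + Φ (-x))]
    · ring
    · intro y hy
      have hy' := hunit y (hxu hy)
      have h1 : HasDerivAt (fun x => Φ (-x)) (-γ (-y)) y := by
        have := (hΦ (0 - y) (by simpa using hy'.2)).comp_const_sub 0 y
        simpa using this
      exact (hΦ y hy'.1).add h1
    · exact ((hγ1.sub hγ2).mono hxu).intervalIntegrable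
  · intro φ hφ
    -- Integrating by parts twice in each variable moves both second derivatives onto `u`; both
    -- equal `γ'(t + x) + γ'(t - x)` and cancel.
    have e1 := weak_pdx_of_classical hφ.pdx (huc.mono subset_closure)
      (hpc.mono subset_closure) hux
    have e2 := weak_pdx_of_classical hφ (hpc.mono subset_closure) (hrc.mono subset_closure) hpx
    have e3 := weak_pdt_of_classical hφ.pdt (huc.mono subset_closure)
      (hqc.mono subset_closure) hut
    have e4 := weak_pdt_of_classical hφ (hqc.mono subset_closure) (hrc.mono subset_closure) hqt
    rw [e2, neg_neg] at e1
    rw [e4, neg_neg] at e3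
    have hint : ∀ ψ, IsTestFunction (domain k) ψ →
        Integrable (fun z => u z * ψ z) (volume.restrict (domain k)) := by
      intro ψ hψ
      have hK : IsCompact (tsupport ψ) := hψ.2.1
      exact (integrable_mul_of_compact hK
        ((huc.mono (hψ.2.2.trans subset_closure)).integrableOn_compact hK (μ := volume))
        hψ.1.continuous (fun z hz => image_eq_zero_of_notMem_tsupport hz)).integrableOn
    simp only [mul_sub]
    rw [integral_sub (hint _ hφ.pdt.pdt) (hint _ hφ.pdx.pdx), e1, e3, sub_self]
  · rw [ae_restrict_iff' measurableSet_Ioi]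
    refine Filter.Eventually.of_forall fun t ht => ?_
    have ht' : 0 < t := ht
    have hrt : r < t := by linarith
    have := (hasDerivAt_dalembert_x (x := 0) (t := t) (hΦ (t + 0) (by simpa using hrt))
      (hΦ (t - 0) (by simpa using hrt))).hasDerivWithinAt (s := Ici 0)
    simpa using this
  · rw [ae_restrict_iff' measurableSet_Ioi]
    refine Filter.Eventually.of_forall fun t ht => ?_
    have ht' : 0 < t := ht
    have h1 : (1 + k) * t + 1 = t + endpoint k t := by simp only [endpoint]; ring
    have h2 : (1 - k) * t - 1 = t - endpoint k t := by simp only [endpoint]; ring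
    have p1 : r < t + endpoint k t := by linarith [hlpos t ht']
    have p2 : r < t - endpoint k t := by rw [← h2]; nlinarith
    refine ⟨_, _, (hasDerivAt_dalembert_x (hΦ _ p1) (hΦ _ p2)).hasDerivWithinAt,
      (hasDerivAt_dalembert_t (hΦ _ p1) (hΦ _ p2)).hasDerivWithinAt, ?_⟩
    have := hbc t ht'
    rw [h1, h2] at this
    linarith
  · intro x _
    simp [hu]
  · rw [ae_restrict_iff' measurableSet_Ioo]
    refine Filter.Eventually.of_forall fun x hx => ?_
    obtain ⟨q1, q2⟩ := hunit x (Ioo_subset_Icc_self hx)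
    have := (hasDerivAt_dalembert_t (x := x) (t := 0) (hΦ (0 + x) (by simpa using q1))
      (hΦ (0 - x) (by simpa using q2))).hasDerivWithinAt (s := Ici 0)
    simpa using this

/-- The initial energy of the solution given by a profile. -/
lemma energy_zero_pos_of_profile {k r : ℝ} (hr : r < -1)
    {Φ γ γ' : ℝ → ℝ} (hΦ : ∀ s, r < s → HasDerivAt Φ (γ s) s)
    (hγ : ∀ s, r < s → HasDerivAt γ (γ' s) s) (h0 : γ 0 ≠ 0) :
    0 < energy k (fun z => Φ (z.2 + z.1) + Φ (z.2 - z.1)) 0 := by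
  have hγc : ContinuousOn γ (Ioi r) := fun s hs => (hγ s hs).continuousAt.continuousWithinAt
  have hunit : ∀ x ∈ Icc (0 : ℝ) 1, r < x ∧ r < -x := fun x hx =>
    ⟨by linarith [hx.1], by linarith [hx.2]⟩
  have hcont : ContinuousOn (fun x => 2 * (γ x ^ 2 + γ (-x) ^ 2)) (Icc 0 1) := by
    have h1 : ContinuousOn γ (Icc 0 1) := hγc.mono fun x hx => (hunit x hx).1
    have h2 : ContinuousOn (fun x => γ (-x)) (Icc 0 1) :=
      hγc.comp (by fun_prop) fun x hx => (hunit x hx).2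
    exact continuousOn_const.mul ((h1.pow 2).add (h2.pow 2))
  have he : ∀ x ∈ Icc (0 : ℝ) 1, energyDensity
      (fun z => Φ (z.2 + z.1) + Φ (z.2 - z.1)) 0 x = 2 * (γ x ^ 2 + γ (-x) ^ 2) := by
    intro x hx
    obtain ⟨q1, q2⟩ := hunit x hx
    have p1 := hΦ (0 + x) (by simpa using q1)
    have p2 := hΦ (0 - x) (by simpa using q2)
    have d1 := (hasDerivAt_dalembert_t p1 p2).hasDerivWithinAt (s := Ici 0)
    have d2 := hasDerivAt_dalembert_x p1 p2
    simp only [energyDensity]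
    rw [d1.derivWithin (uniqueDiffWithinAt_Ici 0), d2.deriv, zero_add, zero_sub]
    ring
  have hend : endpoint k 0 = 1 := by simp [endpoint]
  rw [energy, hend, intervalIntegral.integral_congr (g := fun x => 2 * (γ x ^ 2 + γ (-x) ^ 2))]
  · refine mul_pos (by norm_num) (intervalIntegral.integral_pos zero_lt_one hcont
      (fun x _ => by positivity) ⟨0, by simp, ?_⟩)
    simp only [neg_zero]
    positivity
  · intro x hx
    rw [uIcc_of_le zero_le_one] at hx
    exact he x hx

/-! ### Nonzero solutions -/

/-- A smooth profile satisfying the functional equation of the moving end: a power of `1 + k s`,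
with an oscillating factor if the reflection changes signs. -/
lemma exists_smooth_profile {k a : ℝ} (hk0 : 0 < k) (hk1 : k < 1) (h1 : a ≠ 1) (h2 : a ≠ -1) :
    ∃ γ : ℝ → ℝ, ContDiffOn ℝ ∞ γ (Ioi (-1 / k)) ∧ γ 0 ≠ 0 ∧
      ∀ t, 0 < t → (1 + a) * γ ((1 + k) * t + 1) = (1 - a) * γ ((1 - k) * t - 1) := by
  have hk1' : 0 < 1 - k := by linarith
  obtain ⟨ρ, hρ⟩ : ∃ ρ, ρ = (1 + k) / (1 - k) := ⟨_, rfl⟩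
  have hρ1 : 1 < ρ := by rw [hρ, one_lt_div hk1']; linarith
  have hlogρ : 0 < Real.log ρ := Real.log_pos hρ1
  have ha : 1 + a ≠ 0 := fun h => h2 (by linarith)
  obtain ⟨m, hm⟩ : ∃ m, m = (1 - a) / (1 + a) := ⟨_, rfl⟩
  have hm0 : m ≠ 0 := hm ▸ div_ne_zero (fun h => h1 (by linarith)) ha
  -- Scaling `1 + k s` by `ρ` multiplies its power of exponent `α` by `|m|`.
  obtain ⟨α, hα⟩ : ∃ α, Real.exp (α * Real.log ρ) = |m| :=
    ⟨Real.log |m| / Real.log ρ, by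
      rw [div_mul_cancel₀ _ hlogρ.ne', Real.exp_log (abs_pos.2 hm0)]⟩
  -- If `m < 0`, the same scaling shifts the phase of the cosine by `π`, which produces the sign; if
  -- `m > 0`, no oscillation is needed.
  obtain ⟨θ, hθ⟩ : ∃ θ : ℝ, ∀ z, |m| * Real.cos (θ * Real.log ρ + z) = m * Real.cos z := by
    rcases lt_or_gt_of_ne hm0 with h | h
    · refine ⟨Real.pi / Real.log ρ, fun z => ?_⟩
      rw [div_mul_cancel₀ _ hlogρ.ne', add_comm, Real.cos_add_pi, abs_of_neg h]
      ring
    · exact ⟨0, fun z => by rw [zero_mul, zero_add, abs_of_pos h]⟩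
  refine ⟨fun s => Real.exp (α * Real.log (1 + k * s)) * Real.cos (θ * Real.log (1 + k * s)),
    ?_, by simp, fun t ht => ?_⟩
  · have hlog : ContDiffOn ℝ ∞ (fun s => Real.log (1 + k * s)) (Ioi (-1 / k)) := by
      refine ContDiffOn.log (by fun_prop) fun s hs => ne_of_gt ?_
      rw [mem_Ioi, div_lt_iff₀ hk0] at hs
      linarith
    exact (Real.contDiff_exp.comp_contDiffOn (contDiffOn_const.mul hlog)).mul
      (Real.contDiff_cos.comp_contDiffOn (contDiffOn_const.mul hlog))
  · have hp : 0 < 1 + k * ((1 - k) * t - 1) := by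
      have : 0 < (1 - k) * (1 + k * t) := by positivity
      linarith
    have hw : 1 + k * ((1 + k) * t + 1) = ρ * (1 + k * ((1 - k) * t - 1)) := by
      rw [hρ]; field_simp; ring
    have hlog : Real.log (1 + k * ((1 + k) * t + 1)) =
        Real.log ρ + Real.log (1 + k * ((1 - k) * t - 1)) := by
      rw [hw, Real.log_mul (by linarith) hp.ne']
    have hma : (1 + a) * m = 1 - a := by rw [hm]; field_simp
    simp only [hlog]
    generalize Real.log (1 + k * ((1 - k) * t - 1)) = L
    rw [mul_add, Real.exp_add, hα, mul_add, ← hma]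
    linear_combination (1 + a) * Real.exp (α * L) * hθ (θ * L)

/-- There are nonzero solutions unless reflections at the moving end are degenerate. -/
theorem exists_solution {k a : ℝ} (hk0 : 0 < k) (hk1 : k < 1) (h1 : a ≠ 1) (h2 : a ≠ -1) :
    ∃ u₀ u₁ u, IsWeakSolution k a u₀ u₁ u ∧ 0 < energy k u 0 := by
  obtain ⟨γ, hγd, hγ0, hγbc⟩ := exists_smooth_profile hk0 hk1 h1 h2
  have hγ : ∀ s, -1 / k < s → HasDerivAt γ (deriv γ s) s := fun s hs =>
    ((hγd.differentiableOn (by simp) s hs).differentiableAt (Ioi_mem_nhds hs)).hasDerivAt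
  have hγ' : ContinuousOn (deriv γ) (Ioi (-1 / k)) :=
    hγd.continuousOn_deriv_of_isOpen isOpen_Ioi (by simp)
  have hr : -1 / k < -1 := by
    rw [div_lt_iff₀ hk0]; linarith
  have h0m : (0 : ℝ) ∈ Ioi (-1 / k) := by simp only [mem_Ioi]; linarith
  have hΦ : ∀ s, -1 / k < s → HasDerivAt (fun x => ∫ y in (0 : ℝ)..x, γ y) (γ s) s := by
    intro s hs
    have hcont := hγd.continuousOn
    exact intervalIntegral.integral_hasDerivAt_right
      ((hcont.mono (OrdConnected.uIcc_subset ordConnected_Ioi h0m hs)).intervalIntegrable)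
      (hcont.stronglyMeasurableAtFilter isOpen_Ioi s hs) (hcont.continuousAt (Ioi_mem_nhds hs))
  have hsol := isWeakSolution_of_profile hk0 hk1 hr hΦ hγ hγ' hγbc
  have hpos := energy_zero_pos_of_profile (k := k) hr hΦ hγ hγ0
  exact ⟨_, _, _, hsol, hpos⟩

/-! ### The sign of the reflection factor minus one -/

section Factor

variable {k a : ℝ}

/-- The quadratic in the numerator has roots `a₁` and `a₂`, so it decides between growth and decay
of the unweighted energy. -/
lemma reflectionFactor_zero_sub_one (hk1 : k < 1) (ha : a ≠ -1) :
    reflectionFactor k a 0 - 1 =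
      2 * (k * a ^ 2 - 2 * a + k) / ((1 + a) ^ 2 * (1 - k)) := by
  have ha' : 1 + a ≠ 0 := fun h => ha (by linarith)
  have hk1' : 1 - k ≠ 0 := by linarith
  rw [reflectionFactor, add_zero, Real.rpow_one]
  field_simp
  ring

/-- The numerator changes sign at `b₁ = k` and `b₂ = 1 / k`, so it decides the comparison with
first-order decay. -/
lemma reflectionFactor_one_sub_one (hk1 : k < 1) (ha : a ≠ -1) :
    reflectionFactor k a 1 - 1 =
      4 * ((k - a) * (1 - a * k)) / ((1 + a) ^ 2 * (1 - k) ^ 2) := by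
  have ha' : 1 + a ≠ 0 := fun h => ha (by linarith)
  have hk1' : 1 - k ≠ 0 := by linarith
  rw [reflectionFactor, show (1 : ℝ) + 1 = 2 by norm_num, Real.rpow_two]
  field_simp
  ring

lemma one_lt_reflectionFactor_zero (hk1 : k < 1) (ha : a ≠ -1)
    (h : 0 < k * a ^ 2 - 2 * a + k) : 1 < reflectionFactor k a 0 := by
  have ha' : 1 + a ≠ 0 := fun h => ha (by linarith)
  have hk1' : 0 < 1 - k := by linarith
  rw [← sub_pos, reflectionFactor_zero_sub_one hk1 ha]
  positivity

lemma reflectionFactor_zero_lt_one (hk1 : k < 1) (ha : a ≠ -1)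
    (h : k * a ^ 2 - 2 * a + k < 0) : reflectionFactor k a 0 < 1 := by
  have ha' : 1 + a ≠ 0 := fun h => ha (by linarith)
  have hk1' : 0 < 1 - k := by linarith
  rw [← sub_neg, reflectionFactor_zero_sub_one hk1 ha]
  exact div_neg_of_neg_of_pos (by linarith) (by positivity)

lemma reflectionFactor_one_le_one (hk1 : k < 1) (ha : a ≠ -1)
    (h : (k - a) * (1 - a * k) ≤ 0) : reflectionFactor k a 1 ≤ 1 := by
  rw [← sub_nonpos, reflectionFactor_one_sub_one hk1 ha]
  exact div_nonpos_of_nonpos_of_nonneg (by linarith) (by positivity)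

lemma one_le_reflectionFactor_one (hk1 : k < 1) (ha : a ≠ -1)
    (h : 0 ≤ (k - a) * (1 - a * k)) : 1 ≤ reflectionFactor k a 1 := by
  rw [← sub_nonneg, reflectionFactor_one_sub_one hk1 ha]
  positivity

/-- The weight exponent for which the weighted energy is conserved. -/
lemma reflectionFactor_eq_one (hk0 : 0 < k) (hk1 : k < 1) (h1 : a ≠ 1) (ha : a ≠ -1) :
    reflectionFactor k a
      (-(Real.log (reflectionFactor k a 0) / Real.log ((1 + k) / (1 - k)))) = 1 := by
  have hk1' : 0 < 1 - k := by linarith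
  have ha' : 1 + a ≠ 0 := fun h => ha (by linarith)
  have ha1 : 1 - a ≠ 0 := fun h => h1 (by linarith)
  have hρ : 1 < (1 + k) / (1 - k) := by rw [one_lt_div hk1']; linarith
  have hρ0 : 0 < (1 + k) / (1 - k) := by linarith
  have hpos : 0 < reflectionFactor k a 0 := by
    have : (1 - a) / (1 + a) ≠ 0 := div_ne_zero ha1 ha'
    rw [reflectionFactor]; positivity
  -- The exponent `β` enters only through `ρ ^ β`, so the equation for `β` is solved by a quotient
  -- of logarithms.
  have key : ∀ β, reflectionFactor k a β = reflectionFactor k a 0 * ((1 + k) / (1 - k)) ^ β := by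
    intro β
    rw [reflectionFactor, reflectionFactor, Real.rpow_add hρ0, add_zero, mul_assoc, Real.rpow_one]
  rw [key, Real.rpow_neg hρ0.le, Real.rpow_def_of_pos hρ0, mul_div_cancel₀ _ (Real.log_pos hρ).ne',
    Real.exp_log hpos, mul_inv_cancel₀ hpos.ne']

end Factor

/-! ### Consequences for the energy of solutions -/

section Energy

variable {k a : ℝ}

/-- Monotonicity is the case `β = 0`; strict growth comes from waiting for a complete reflection. At
`a = -1` every energy vanishes, so no condition on the quadratic is needed there. -/
lemma energyIncreasing (hk0 : 0 < k) (hk1 : k < 1) (h : a ≠ -1 → 0 < k * a ^ 2 - 2 * a + k) :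
    EnergyIncreasing k a := by
  intro u₀ u₁ u hu
  obtain ⟨g, hg, hE⟩ := hu.exists_isProfile hk0 hk1
  rcases eq_or_ne a (-1) with rfl | ha
  · have hz : ∀ t, 0 ≤ t → energy k u t = 0 := fun t ht => by
      rw [(hE t ht).2, hg.energy_eq_zero hk0 hk1 ht]
    exact ⟨fun s hs t ht _ => by rw [hz s hs, hz t ht],
      fun s hs hpos => absurd (hz s hs) hpos.ne'⟩
  · have hr := one_lt_reflectionFactor_zero hk1 ha (h ha)
    refine ⟨fun s hs t ht hst => ?_, fun s hs hpos => ?_⟩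
    · rw [(hE s hs).2, (hE t ht).2]
      exact hg.weightedEnergy_mono hk0 hk1 ha 0 hr.le hs hst
    · obtain ⟨t, hst, ht⟩ := hg.exists_later_energy hk0 hk1 ha hs
      refine ⟨t, hst, ?_⟩
      rw [(hE s hs).2] at hpos
      rw [(hE s hs).2, (hE t (hs.trans hst.le)).2, ht]
      exact lt_mul_of_one_lt_left hpos hr

lemma energyDecreasing (hk0 : 0 < k) (hk1 : k < 1) (ha : a ≠ -1)
    (h : k * a ^ 2 - 2 * a + k < 0) : EnergyDecreasing k a := by
  intro u₀ u₁ u hu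
  obtain ⟨g, hg, hE⟩ := hu.exists_isProfile hk0 hk1
  have hr := reflectionFactor_zero_lt_one hk1 ha h
  refine ⟨fun s hs t ht hst => ?_, fun s hs hpos => ?_⟩
  · rw [(hE s hs).2, (hE t ht).2]
    exact hg.weightedEnergy_anti hk0 hk1 ha 0 hr.le hs hst
  · obtain ⟨t, hst, ht⟩ := hg.exists_later_energy hk0 hk1 ha hs
    refine ⟨t, hst, ?_⟩
    rw [(hE s hs).2] at hpos
    rw [(hE s hs).2, (hE t (hs.trans hst.le)).2, ht]
    exact mul_lt_of_lt_one_left hpos hr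

lemma energyConserved (hk0 : 0 < k) (hk1 : k < 1) (ha : a ≠ -1)
    (h : k * a ^ 2 - 2 * a + k = 0) : EnergyConserved k a := by
  intro u₀ u₁ u hu t ht
  obtain ⟨g, hg, hE⟩ := hu.exists_isProfile hk0 hk1
  have hr : reflectionFactor k a 0 = 1 := by
    rw [← sub_eq_zero, reflectionFactor_zero_sub_one hk1 ha, h]
    simp
  rw [(hE t ht).2, (hE 0 le_rfl).2]
  exact le_antisymm (hg.weightedEnergy_anti hk0 hk1 ha 0 hr.le le_rfl ht)
    (hg.weightedEnergy_mono hk0 hk1 ha 0 hr.ge le_rfl ht)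

/-- Every nonzero solution has energy comparable with a power of time. -/
lemma IsWeakSolution.energyComparableToPower (hk0 : 0 < k) (hk1 : k < 1) (h1 : a ≠ 1)
    (ha : a ≠ -1) {u₀ u₁ : ℝ → ℝ} {u : ℝ × ℝ → ℝ} (hu : IsWeakSolution k a u₀ u₁ u)
    (hpos : 0 < energy k u 0) :
    EnergyComparableToPower k u
      (Real.log (reflectionFactor k a 0) / Real.log ((1 + k) / (1 - k))) := by
  obtain ⟨g, hg, hE⟩ := hu.exists_isProfile hk0 hk1
  obtain ⟨c₁, c₂, hc1, hc2, hc⟩ :=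
    hg.energy_comparable hk0 hk1 ha (reflectionFactor_eq_one hk0 hk1 h1 ha)
  refine ⟨hpos, c₁, c₂, hc1, hc2, fun t ht => ?_⟩
  rw [(hE t ht).2, (hE 0 le_rfl).2]
  simpa using hc t ht

lemma existsPolynomialGrowth (hk0 : 0 < k) (hk1 : k < 1) (h1 : a ≠ 1) (ha : a ≠ -1)
    (h : 0 < k * a ^ 2 - 2 * a + k) : ExistsPolynomialGrowth k a := by
  obtain ⟨u₀, u₁, u, hu, hpos⟩ := exists_solution hk0 hk1 h1 ha
  have hρ : 1 < (1 + k) / (1 - k) := by rw [one_lt_div (by linarith)]; linarith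
  exact ⟨u₀, u₁, u, hu, _,
    div_pos (Real.log_pos (one_lt_reflectionFactor_zero hk1 ha h)) (Real.log_pos hρ),
    hu.energyComparableToPower hk0 hk1 h1 ha hpos⟩

lemma existsPolynomialDecay (hk0 : 0 < k) (hk1 : k < 1) (h1 : a ≠ 1) (ha : a ≠ -1)
    (h : k * a ^ 2 - 2 * a + k < 0) : ExistsPolynomialDecay k a := by
  obtain ⟨u₀, u₁, u, hu, hpos⟩ := exists_solution hk0 hk1 h1 ha
  have hk1' : 0 < 1 - k := by linarith
  have ha' : 1 + a ≠ 0 := fun h => ha (by linarith)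
  have ha1 : (1 - a) / (1 + a) ≠ 0 := div_ne_zero (fun h => h1 (by linarith)) ha'
  have hρ : 1 < (1 + k) / (1 - k) := by rw [one_lt_div hk1']; linarith
  have hr0 : 0 < reflectionFactor k a 0 := by rw [reflectionFactor]; positivity
  have hlog := Real.log_neg hr0 (reflectionFactor_zero_lt_one hk1 ha h)
  refine ⟨u₀, u₁, u, hu, -(Real.log (reflectionFactor k a 0) / Real.log ((1 + k) / (1 - k))),
    neg_pos.2 (div_neg_of_neg_of_pos hlog (Real.log_pos hρ)), ?_⟩
  rw [neg_neg]
  exact hu.energyComparableToPower hk0 hk1 h1 ha hpos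

lemma IsWeakSolution.energy_le (hk0 : 0 < k) (hk1 : k < 1) (ha : a ≠ -1)
    (h : (k - a) * (1 - a * k) ≤ 0) {u₀ u₁ : ℝ → ℝ} {u : ℝ × ℝ → ℝ}
    (hu : IsWeakSolution k a u₀ u₁ u) {T : ℝ} (hT : 0 ≤ T) :
    energy k u T ≤ (1 + k) / ((1 - k) * (1 + k * T)) * energy k u 0 := by
  obtain ⟨g, hg, hE⟩ := hu.exists_isProfile hk0 hk1
  rw [(hE T hT).2, (hE 0 le_rfl).2]
  exact hg.energy_le_first_order hk0 hk1 ha (reflectionFactor_one_le_one hk1 ha h) hT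

lemma IsWeakSolution.le_energy (hk0 : 0 < k) (hk1 : k < 1) (ha : a ≠ -1)
    (h : 0 ≤ (k - a) * (1 - a * k)) {u₀ u₁ : ℝ → ℝ} {u : ℝ × ℝ → ℝ}
    (hu : IsWeakSolution k a u₀ u₁ u) {T : ℝ} (hT : 0 ≤ T) :
    (1 - k) / ((1 + k) * (1 + k * T)) * energy k u 0 ≤ energy k u T := by
  obtain ⟨g, hg, hE⟩ := hu.exists_isProfile hk0 hk1
  rw [(hE T hT).2, (hE 0 le_rfl).2]
  exact hg.first_order_le_energy hk0 hk1 ha (one_le_reflectionFactor_one hk1 ha h) hT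

open Polynomial in
lemma exists_ratePolynomial (hk0 : 0 < k) :
    ∃ φ : Polynomial ℝ, IsRatePolynomial 1 φ ∧ ∀ t, φ.eval t = 1 + k * t := by
  have he : ∀ t : ℝ, (C k * X + C 1).eval t = 1 + k * t := fun t => by simp [add_comm]
  refine ⟨C k * X + C 1, ⟨natDegree_linear hk0.ne', fun t ht => ?_⟩, he⟩
  rw [he]
  positivity

lemma decaysAtLeastAtOrder_one (hk0 : 0 < k) (hk1 : k < 1) (ha : a ≠ -1)
    (h : (k - a) * (1 - a * k) ≤ 0) : DecaysAtLeastAtOrder k a 1 := by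
  obtain ⟨φ, hφ, he⟩ := exists_ratePolynomial hk0
  have hk1' : 0 < 1 - k := by linarith
  refine ⟨(1 + k) / (1 - k), by positivity, φ, hφ, fun u₀ u₁ u hu t ht => ?_⟩
  refine (hu.energy_le hk0 hk1 ha h ht).trans_eq ?_
  rw [he]
  field_simp

lemma decaysAtMostAtOrder_one (hk0 : 0 < k) (hk1 : k < 1) (ha : a ≠ -1)
    (h : 0 ≤ (k - a) * (1 - a * k)) : DecaysAtMostAtOrder k a 1 := by
  obtain ⟨φ, hφ, he⟩ := exists_ratePolynomial hk0
  have hk1' : 0 < 1 - k := by linarith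
  refine ⟨(1 - k) / (1 + k), by positivity, φ, hφ, fun u₀ u₁ u hu t ht => ?_⟩
  refine Eq.trans_le ?_ (hu.le_energy hk0 hk1 ha h ht)
  rw [he]
  field_simp

lemma decaysExactlyAtOrder_one (hk0 : 0 < k) (hk1 : k < 1) (ha : a ≠ -1)
    (h : (k - a) * (1 - a * k) = 0) : DecaysExactlyAtOrder k a 1 := by
  obtain ⟨φ, hφ, he⟩ := exists_ratePolynomial hk0
  have hk1' : 0 < 1 - k := by linarith
  refine ⟨(1 - k) / (1 + k), (1 + k) / (1 - k), by positivity, by positivity, φ, hφ,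
    fun u₀ u₁ u hu t ht => ⟨?_, ?_⟩⟩
  · refine Eq.trans_le ?_ (hu.le_energy hk0 hk1 ha h.ge ht)
    rw [he]
    field_simp
  · refine (hu.energy_le hk0 hk1 ha h.le ht).trans_eq ?_
    rw [he]
    field_simp

end Energy

end MovingWave

end

/-! ### The thresholds and the final assembly -/

theorem theorem1p1 (k a₁ a₂ b₁ b₂ : ℝ) (hk0 : 0 < k) (hk1 : k < 1)
    (ha₁ : a₁ = (1 - Real.sqrt (1 - k ^ 2)) / k)
    (ha₂ : a₂ = (1 + Real.sqrt (1 - k ^ 2)) / k)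
    (hb₁ : b₁ = k) (hb₂ : b₂ = 1 / k) :
    -- ordering of the thresholds
    (a₁ < b₁ ∧ b₁ < b₂ ∧ b₂ < a₂) ∧
    -- the energy of every solution is well defined at every time
    (∀ (a : ℝ) (u₀ u₁ : ℝ → ℝ) (u : ℝ × ℝ → ℝ), MovingWave.IsWeakSolution k a u₀ u₁ u →
      ∀ t : ℝ, 0 ≤ t → MovingWave.EnergyWellDefined k u t) ∧
    -- growth
    (∀ a : ℝ, a < a₁ ∨ a₂ < a →
      MovingWave.EnergyIncreasing k a ∧
      (a ≠ -1 → MovingWave.ExistsPolynomialGrowth k a)) ∧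
    -- conservation
    (∀ a : ℝ, a = a₁ ∨ a = a₂ → MovingWave.EnergyConserved k a) ∧
    -- decay
    (∀ a : ℝ, a₁ < a → a < a₂ →
      MovingWave.EnergyDecreasing k a ∧
      (a ≠ 1 → MovingWave.ExistsPolynomialDecay k a)) ∧
    -- decay of exactly first order, with explicit two-sided bounds
    (∀ a : ℝ, a = b₁ ∨ a = b₂ →
      MovingWave.DecaysExactlyAtOrder k a 1 ∧
      ∀ (u₀ u₁ : ℝ → ℝ) (u : ℝ × ℝ → ℝ), MovingWave.IsWeakSolution k a u₀ u₁ u →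
        ∀ T : ℝ, 0 ≤ T →
          (1 - k) / ((1 + k) * (1 + k * T)) * MovingWave.energy k u 0 ≤
              MovingWave.energy k u T ∧
          MovingWave.energy k u T ≤
            (1 + k) / ((1 - k) * (1 + k * T)) * MovingWave.energy k u 0) ∧
    -- decay of at least first order
    (∀ a : ℝ, b₁ < a → a < b₂ → MovingWave.DecaysAtLeastAtOrder k a 1) ∧
    -- decay of at most first order
    (∀ a : ℝ, (a₁ < a ∧ a < b₁) ∨ (b₂ < a ∧ a < a₂) →
      MovingWave.DecaysAtMostAtOrder k a 1) := by
  rw [hb₁, hb₂]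
  obtain ⟨r, hr⟩ : ∃ r, r = Real.sqrt (1 - k ^ 2) := ⟨_, rfl⟩
  rw [← hr] at ha₁ ha₂
  have hk2 : 0 < 1 - k ^ 2 := by nlinarith
  have hr0 : 0 < r := hr ▸ Real.sqrt_pos.2 hk2
  have hrsq : r ^ 2 = 1 - k ^ 2 := hr ▸ Real.sq_sqrt hk2.le
  have hlo : 1 - k < r := by nlinarith
  have hr1 : r < 1 := by nlinarith
  -- As `k ^ 2 = 1 - r ^ 2`, this is `r ^ 2 < r`; it gives `a₁ < k`.
  have hlo2 : 1 - r < k ^ 2 := by nlinarith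
  have hka1 : k * a₁ = 1 - r := by rw [ha₁]; field_simp
  have hka2 : k * a₂ = 1 + r := by rw [ha₂]; field_simp
  have hkb : k * (1 / k) = 1 := by field_simp
  have ha1pos : 0 < a₁ := by rw [ha₁]; exact div_pos (by linarith) hk0
  have o1 : a₁ < k := by
    have : k * a₁ < k * k := by rw [hka1]; linarith
    exact lt_of_mul_lt_mul_left this hk0.le
  have o2 : k < 1 / k := by
    rw [lt_div_iff₀ hk0]; linarith
  have o3 : 1 / k < a₂ := by
    have : k * (1 / k) < k * a₂ := by rw [hkb, hka2]; linarith
    exact lt_of_mul_lt_mul_left this hk0.le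
  -- Vieta: `a₁ + a₂ = 2 / k` and `a₁ a₂ = 1`.
  have hquad : ∀ a : ℝ, k * a ^ 2 - 2 * a + k = k * ((a - a₁) * (a - a₂)) := by
    intro a
    have h1 : a₁ + a₂ = 2 / k := by rw [ha₁, ha₂]; ring
    have h2 : a₁ * a₂ = 1 := by
      rw [ha₁, ha₂]
      field_simp
      linarith
    have : k * (a₁ + a₂) = 2 := by rw [h1]; field_simp
    linear_combination a * this - k * h2
  have hlin : ∀ a : ℝ, (k - a) * (1 - a * k) = k * ((a - k) * (a - 1 / k)) := by
    intro a
    linear_combination (a - k) * hkb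
  have hinc : ∀ a : ℝ, a < a₁ ∨ a₂ < a → 0 < k * a ^ 2 - 2 * a + k := by
    rintro a (h | h)
    · rw [hquad]
      exact mul_pos hk0 (mul_pos_of_neg_of_neg (by linarith) (by linarith))
    · rw [hquad]
      exact mul_pos hk0 (mul_pos (by linarith) (by linarith))
  have hdec : ∀ a : ℝ, a₁ < a → a < a₂ → k * a ^ 2 - 2 * a + k < 0 := by
    intro a h1 h2
    rw [hquad]
    exact mul_neg_of_pos_of_neg hk0 (mul_neg_of_pos_of_neg (by linarith) (by linarith))
  refine ⟨⟨o1, o2, o3⟩, ?_, ?_, ?_, ?_, ?_, ?_, ?_⟩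
  · intro a u₀ u₁ u hu t ht
    obtain ⟨g, -, hE⟩ := hu.exists_isProfile hk0 hk1
    exact (hE t ht).1
  · intro a ha
    refine ⟨MovingWave.energyIncreasing hk0 hk1 fun _ => hinc a ha, fun ha' => ?_⟩
    refine MovingWave.existsPolynomialGrowth hk0 hk1 ?_ ha' (hinc a ha)
    -- At `a = 1` the quadratic equals `2 k - 2 < 0`, so this value lies outside the growth range.
    rintro rfl
    have := hinc 1 ha
    linarith
  · intro a ha
    refine MovingWave.energyConserved hk0 hk1 ?_ ?_
    · rcases ha with rfl | rfl <;> linarith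
    · rw [hquad]
      rcases ha with rfl | rfl <;> ring
  · intro a h1 h2
    exact ⟨MovingWave.energyDecreasing hk0 hk1 (by linarith) (hdec a h1 h2), fun ha =>
      MovingWave.existsPolynomialDecay hk0 hk1 ha (by linarith) (hdec a h1 h2)⟩
  · intro a ha
    have hne : a ≠ -1 := by rcases ha with rfl | rfl <;> linarith
    have h0 : (k - a) * (1 - a * k) = 0 := by
      rw [hlin]
      rcases ha with rfl | rfl <;> ring
    exact ⟨MovingWave.decaysExactlyAtOrder_one hk0 hk1 hne h0, fun u₀ u₁ u hu T hT =>
      ⟨hu.le_energy hk0 hk1 hne h0.ge hT, hu.energy_le hk0 hk1 hne h0.le hT⟩⟩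
  · intro a h1 h2
    refine MovingWave.decaysAtLeastAtOrder_one hk0 hk1 (by linarith) ?_
    rw [hlin]
    exact (mul_neg_of_pos_of_neg hk0 (mul_neg_of_pos_of_neg (by linarith) (by linarith))).le
  · rintro a (⟨h1, h2⟩ | ⟨h1, h2⟩)
    · refine MovingWave.decaysAtMostAtOrder_one hk0 hk1 (by linarith) ?_
      rw [hlin]
      exact (mul_pos hk0 (mul_pos_of_neg_of_neg (by linarith) (by linarith))).le
    · refine MovingWave.decaysAtMostAtOrder_one hk0 hk1 (by linarith) ?_
      rw [hlin]
      exact (mul_pos hk0 (mul_pos (by linarith) (by linarith))).le
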